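/- Let $S$ be a closed connected oriented surface of genus at least two, with universal cover $\tilde S$, on which $\pi_1(S)$ acts by deck transformations. A $\mathbb{CP}^1$-structure on $S$ is given by a pair $(f,\rho)$ of a local homeomorphism $f\colon\tilde S\to\mathbb{CP}^1$ (the developing map) and a homomorphism $\rho\colon\pi_1(S)\to\mathrm{PSL}(2,\mathbb C)$ (the holonomy representation) such that $f$ is $\rho$-equivariant. Let $\mathsf P$ be the deformation space of marked $\mathbb{CP}^1$-structures on $S$: such pairs, with the topology of uniform convergence of $f$ on compact sets and convergence of $\rho$, modulo $(f,\rho)\sim(Af,A\rho A^{-1})$ for $A\in\mathrm{PSL}(2,\mathbb C)$ and modulo isotopy of $S$, with the quotient topology. Let $\mathcal R=\mathrm{Hom}(\pi_1(S),\mathrm{PSL}(2,\mathbb C))$ be the representation variety, with the topology of pointwise convergence (equivalently, the topology induced from $\mathrm{PSL}(2,\mathbb C)^n$ by evaluation at a generating set $\gamma_1,\dots,\gamma_n$), and let $\chi=\mathcal R/\!\!/\mathrm{PSL}(2,\mathbb C)$ be the character variety, i.e. the GIT quotient of $\mathcal R$ by conjugation: its points are the classes $[\rho]$ for the relation $\rho_1\sim\rho_2$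 if and only if the closures in $\mathcal R$ of the conjugation orbits of $\rho_1$ and $\rho_2$ intersect, and its topology is the quotient topology. The holonomy map $\mathrm{Hol}\colon\mathsf P\to\chi$ sends the class of $(f,\rho)$ to $[\rho]$. Proposition. Let $C_t$ $(t\ge 0)$ be a continuous path in $\mathsf P$ whose holonomy $\eta_t=\mathrm{Hol}(C_t)\in\chi$ converges to some $\eta_\infty\in\chi$ as $t\to\infty$. Then there are a continuous path $\rho_t$ $(t\ge 0)$ in $\mathcal R$ and $\rho_\infty\in\mathcal R$ such that $[\rho_t]=\eta_t$ for all $t\ge 0$, $\rho_t\to\rho_\infty$ in $\mathcal R$ as $t\to\infty$, and $[\rho_\infty]=\eta_\infty$. (Nothing is assumed about $\eta_\infty$: it may be elementary, or even the class of the trivial representation.) -/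

import Mathlib

open Filter Topology
open scoped Manifold ContDiff NNReal unitInterval LinearAlgebra.Projectivization

namespace NeckPinching

noncomputable section

/-! ### Closed oriented surfaces -/

/-- The atlas of a smooth surface is oriented: all coordinate changes have positive Jacobian
determinant. -/
def IsOrientedAtlas (S : Type*) [TopologicalSpace S]
    [ChartedSpace (EuclideanSpace ℝ (Fin 2)) S] : Prop :=
  ∀ e ∈ atlas (EuclideanSpace ℝ (Fin 2)) S, ∀ e' ∈ atlas (EuclideanSpace ℝ (Fin 2)) S,
    ∀ x ∈ (e.symm.trans e').source, 0 < (fderiv ℝ (e.symm.trans e') x).det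

/-- A closed connected oriented surface has genus `g` if its first Betti number, that is, the rank
of the abelianization of its fundamental group, equals `2 * g`. -/
def HasGenus (S : Type*) [TopologicalSpace S] (g : ℕ) : Prop :=
  ∀ x : S, Module.finrank ℤ (Additive (Abelianization (FundamentalGroup S x))) = 2 * g

/-- The group of deck transformations of `p`. When `p` is the universal covering of `S`, this is
the fundamental group of `S` together with its action on the universal cover. -/
def DeckGroup {S E : Type*} [TopologicalSpace E] (p : E → S) : Subgroup (E ≃ₜ E) where
  carrier := {h | ∀ x, p (h x) = p x}
  mul_mem' {a b} ha hb x := by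
    change p (a (b x)) = p x
    rw [ha, hb]
  one_mem' _ := rfl
  inv_mem' {a} ha x := by
    have h := ha (a.symm x)
    rw [Homeomorph.apply_symm_apply] at h
    exact h.symm

/-! ### `PSL(2, ℂ)` and the complex projective line -/

/-- The group `PSL(2, ℂ)`, with the quotient topology of `SL(2, ℂ)`. -/
abbrev PSL2C : Type := Matrix.ProjectiveSpecialLinearGroup (Fin 2) ℂ

/-- The complex projective line, on which `PSL(2, ℂ)` acts by projective transformations. -/
abbrev CP1 : Type := ℙ ℂ (Fin 2 → ℂ)

/-- The complex projective line carries the quotient topology of `ℂ² ∖ {0}`. -/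
instance : TopologicalSpace CP1 :=
  TopologicalSpace.coinduced
    (fun v : {v : Fin 2 → ℂ // v ≠ 0} => Projectivization.mk ℂ v.1 v.2) inferInstance

/-! ### Representation variety and character variety -/

/-- The `PSL(2, ℂ)`-representation variety of a group. -/
abbrev RepresentationVariety (Γ : Type*) [Group Γ] : Type _ := Γ →* PSL2C

/-- The topology of pointwise convergence. If `γ₁, …, γₙ` generate `Γ`, it is the one induced by
the embedding `ρ ↦ (ρ γ₁, …, ρ γₙ)` into `PSL(2, ℂ)ⁿ`. -/
instance (Γ : Type*) [Group Γ] : TopologicalSpace (RepresentationVariety Γ) :=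
  TopologicalSpace.induced (fun ρ γ => ρ γ) inferInstance

/-- The conjugation action of `PSL(2, ℂ)` on representations. -/
def conjRep {Γ : Type*} [Group Γ] (A : PSL2C) (ρ : RepresentationVariety Γ) :
    RepresentationVariety Γ :=
  (MulAut.conj A).toMonoidHom.comp ρ

/-- The orbit of a representation under conjugation. -/
def conjOrbit {Γ : Type*} [Group Γ] (ρ : RepresentationVariety Γ) :
    Set (RepresentationVariety Γ) :=
  Set.range fun A : PSL2C => conjRep A ρ

/-- Extended orbit equivalence: the closures of the two orbits intersect. -/
def ExtendedOrbitEquiv {Γ : Type*} [Group Γ] (ρ₁ ρ₂ : RepresentationVariety Γ) : Prop :=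
  (closure (conjOrbit ρ₁) ∩ closure (conjOrbit ρ₂)).Nonempty

/-- The `PSL(2, ℂ)`-character variety: the GIT quotient of the representation variety by
conjugation, as a topological space. Its points are the extended orbit equivalence classes, and its
topology is the quotient topology. -/
def CharacterVariety (Γ : Type*) [Group Γ] : Type _ :=
  Quot (ExtendedOrbitEquiv (Γ := Γ))

instance (Γ : Type*) [Group Γ] : TopologicalSpace (CharacterVariety Γ) :=
  inferInstanceAs (TopologicalSpace (Quot (ExtendedOrbitEquiv (Γ := Γ))))

/-- The quotient map `ρ ↦ [ρ]` from the representation variety to the character variety. -/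
def toCharacterVariety {Γ : Type*} [Group Γ] (ρ : RepresentationVariety Γ) :
    CharacterVariety Γ :=
  Quot.mk _ ρ

/-! ### Complex projective structures -/

section ProjectiveStructures

variable {S E : Type*} [TopologicalSpace E]

/-- A `ℂP¹`-structure on `S`, given on the universal cover `p : E → S` by its developing map and
its holonomy representation. -/
structure DevelopingPair (p : E → S) where
  /-- the developing map -/
  dev : C(E, CP1)
  /-- the holonomy representation -/
  hol : RepresentationVariety (DeckGroup p)
  isLocalHomeomorph : IsLocalHomeomorph dev
  equivariant : ∀ (γ : DeckGroup p) (x : E), dev ((γ : E ≃ₜ E) x) = hol γ • dev x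

/-- Convergence of developing pairs: the developing maps converge uniformly on compact subsets and
the holonomy representations converge. -/
instance (p : E → S) : TopologicalSpace (DevelopingPair p) :=
  TopologicalSpace.induced (fun C => (C.dev, C.hol)) inferInstance

/-- `φ` is the end of an isotopy starting at the identity through homeomorphisms of the universal
cover that commute with the deck group; equivalently, `φ` is the lift of a self-homeomorphism of `S`
isotopic to the identity, along a lift of the isotopy that starts at the identity. -/
def IsLiftOfIsotopyFromId (p : E → S) (φ : E ≃ₜ E) : Prop :=
  ∃ Φ : I → (E ≃ₜ E), Continuous (fun q : I × E => Φ q.1 q.2) ∧ Φ 0 = 1 ∧ Φ 1 = φ ∧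
    ∀ (s : I) (γ : DeckGroup p) (x : E), Φ s ((γ : E ≃ₜ E) x) = (γ : E ≃ₜ E) (Φ s x)

/-- Two developing pairs define the same marked `ℂP¹`-structure: they differ by the action
`(f, ρ) ↦ (A f, A ρ A⁻¹)` of `PSL(2, ℂ)` and by an isotopy of the surface. -/
def DevelopingPair.Equiv {p : E → S} (C C' : DevelopingPair p) : Prop :=
  ∃ (A : PSL2C) (φ : E ≃ₜ E), IsLiftOfIsotopyFromId p φ ∧
    (∀ x, C'.dev x = A • C.dev (φ x)) ∧ C'.hol = conjRep A C.hol

/-- The deformation space of marked `ℂP¹`-structures, with the quotient topology. -/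
def DeformationSpace (p : E → S) : Type _ :=
  Quot (DevelopingPair.Equiv (p := p))

instance (p : E → S) : TopologicalSpace (DeformationSpace p) :=
  inferInstanceAs (TopologicalSpace (Quot (DevelopingPair.Equiv (p := p))))

theorem conjRep_one {Γ : Type*} [Group Γ] (ρ : RepresentationVariety Γ) : conjRep 1 ρ = ρ := by
  ext γ
  simp [conjRep]

/-- The holonomy map from the deformation space to the character variety. -/
def holonomy {p : E → S} : DeformationSpace p → CharacterVariety (DeckGroup p) :=
  Quot.lift (fun C => toCharacterVariety C.hol) (by
    rintro C C' ⟨A, φ, -, -, h⟩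
    refine Quot.sound ⟨C'.hol, subset_closure ⟨A, h.symm⟩, subset_closure ⟨1, conjRep_one _⟩⟩)

end ProjectiveStructures

end

end NeckPinching

/-! The projective structures enter through the continuity of `holonomy`. The rest is a path lifting
theorem for the character variety of a finitely generated group. The deck group is finitely
generated because it acts properly discontinuously on the universal cover, with compact quotient
(`deckGroup_fg`). The parameter range with its limit at infinity is compressed to an interval, so
that the limit is an ordinary point of the path and convergence of the lift is continuity
(`exists_convergent_path_lift`).

Conjugation orbits need be neither compact nor closed. Following Kempf and Ness, the GIT quotient is
replaced by a quotient by a compact group. A representation is recorded by matrices in SL(2,ℂ) for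
the generators, up to signs, and its energy is the sum of their squared Frobenius norms. The closure
of each orbit contains a tuple minimizing the energy in its own orbit (`exists_mem_minimalLifts`),
and minimal tuples with the same class differ by SU(2) and signs
(`unitaryEquiv_of_toCharacterVariety_eq`). The uniqueness rests on `eq_of_tendsto_diagSL_smul`:
along the diagonal factor of a Cartan decomposition, the equality of `upper` and `lower` at minimal
tuples controls the displacement. The correspondence is also closed
(`isClosed_setOf_toCharacterVariety`), so fibers vary semicontinuously.

Paths then lift along the finite quotient by signs (`LiftsPaths.of_finite`) and along the quotient
by SU(2) (`liftsPaths_toOrbit`). Both use the dichotomy of `LiftsPaths.of_local`. Where the whole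
group fixes a point, its fiber is that point alone, and any choice of lift is continuous there.
Elsewhere a slice reduces the problem to a smaller group. For signs this is an induction on the
order; for SU(2) the chain is SU(2), the diagonal torus, and the center, which acts trivially by
conjugation. Lifts over the open set of good parameters are glued along intervals, without control
at the ends, which the first case makes unnecessary. -/

namespace NeckPinching

/-! ### Lifting paths -/

section PathLifting

variable {X Y : Type*} [TopologicalSpace X]

variable [TopologicalSpace Y] in
/-- Every path in `V`, parametrized by the real line, lifts along `q` to a path in `S`. -/
def LiftsPaths (q : X → Y) (S : Set X) (V : Set Y) : Prop :=
  ∀ f : ℝ → Y, Continuous f → (∀ t, f t ∈ V) →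
    ∃ L : ℝ → X, Continuous L ∧ ∀ t, L t ∈ S ∧ q (L t) = f t

variable [TopologicalSpace Y] in
theorem LiftsPaths.mono {q : X → Y} {S S' : Set X} {V V' : Set Y} (h : LiftsPaths q S V)
    (hS : S ⊆ S') (hV : V' ⊆ V) : LiftsPaths q S' V' := fun f hf hfV => by
  obtain ⟨L, hL, h⟩ := h f hf fun t => hV (hfV t)
  exact ⟨L, hL, fun t => ⟨hS (h t).1, (h t).2⟩⟩

/-- Points of `S` in the same fiber of `q` are exchanged by continuous fiber preserving maps. -/
def TransitiveOnFibers (q : X → Y) (S : Set X) : Prop :=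
  ∀ x ∈ S, ∀ x' ∈ S, q x = q x' →
    ∃ g : X → X, Continuous g ∧ (∀ z ∈ S, g z ∈ S ∧ q (g z) = q z) ∧ g x = x'

/-- `L` lifts `f` along `q` to a path in `S`, over the set `J` of parameters. -/
def IsLiftOn (q : X → Y) (S : Set X) (f : ℝ → Y) (L : ℝ → X) (J : Set ℝ) : Prop :=
  ContinuousOn L J ∧ ∀ t ∈ J, L t ∈ S ∧ q (L t) = f t

variable {q : X → Y} {S : Set X} {V : Set Y} {f : ℝ → Y}

theorem IsLiftOn.congr {L L' : ℝ → X} {J : Set ℝ} (h : IsLiftOn q S f L J) (hJ : Set.EqOn L' L J) :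
    IsLiftOn q S f L' J := ⟨h.1.congr hJ, fun t ht => by rw [hJ ht]; exact h.2 t ht⟩

theorem IsLiftOn.union {L : ℝ → X} {J J' : Set ℝ} (h : IsLiftOn q S f L J)
    (h' : IsLiftOn q S f L J') (hJ : IsClosed J) (hJ' : IsClosed J') :
    IsLiftOn q S f L (J ∪ J') :=
  ⟨h.1.union_of_isClosed h'.1 hJ hJ', fun t ht => ht.elim (h.2 t) (h'.2 t)⟩

/-- A lift over an interval extends to an adjacent interval over which some lift exists. -/
theorem IsLiftOn.glue (htr : TransitiveOnFibers q S) {J J' : Set ℝ} (hJ : IsClosed J)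
    (hJ' : IsClosed J') {b : ℝ} (hbJ : b ∈ J) (hbJ' : b ∈ J') (hb : J ∩ J' ⊆ {b}) {L L' : ℝ → X}
    (h : IsLiftOn q S f L J) (h' : IsLiftOn q S f L' J') :
    ∃ L'' : ℝ → X, IsLiftOn q S f L'' (J ∪ J') ∧ Set.EqOn L'' L J := by
  classical
  -- The second lift is moved inside the fibers until it agrees with the first at `b`; the first is
  -- left unchanged.
  obtain ⟨g, hg, hgS, hgb⟩ := htr (L' b) (h'.2 b hbJ').1 (L b) (h.2 b hbJ).1
    (by rw [(h'.2 b hbJ').2, (h.2 b hbJ).2])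
  have e : Set.EqOn (fun t => if t ∈ J then L t else g (L' t)) L J := fun t ht => if_pos ht
  refine ⟨fun t => if t ∈ J then L t else g (L' t), ?_, e⟩
  refine (h.congr e).union (IsLiftOn.congr (L := fun t => g (L' t)) ?_ ?_) hJ hJ'
  · refine ⟨hg.comp_continuousOn h'.1, fun t ht => ?_⟩
    obtain ⟨h1, h2⟩ := hgS _ (h'.2 t ht).1
    exact ⟨h1, h2.trans (h'.2 t ht).2⟩
  · intro t ht
    by_cases htJ : t ∈ J
    · obtain rfl : t = b := hb ⟨htJ, ht⟩
      simp [htJ, hgb]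
    · simp [htJ]

variable [TopologicalSpace Y]

/-- Lifts exist over compact intervals as soon as they exist locally. -/
theorem exists_isLiftOn_Icc (htr : TransitiveOnFibers q S) (hf : Continuous f) {a b : ℝ}
    (hab : a ≤ b)
    (hloc : ∀ t ∈ Set.Icc a b, ∃ V', IsOpen V' ∧ f t ∈ V' ∧ LiftsPaths q S V') :
    ∃ L, IsLiftOn q S f L (Set.Icc a b) := by
  choose! W hWo hWf hWl using hloc
  have hsub (u v : ℝ) (huv : u ≤ v) (t : ℝ) (ht : t ∈ Set.Icc a b)
      (h : ∀ s ∈ Set.Icc u v, f s ∈ W t) : ∃ L, IsLiftOn q S f L (Set.Icc u v) := by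
    -- `LiftsPaths` concerns paths over the whole line, so the restriction of `f` to `Icc u v` is
    -- extended by constants.
    obtain ⟨L, hL, hL'⟩ := hWl t ht (fun s => f (Set.projIcc u v huv s))
      (hf.comp (continuous_subtype_val.comp continuous_projIcc)) (fun s => h _ (Set.projIcc u v huv s).2)
    refine ⟨L, hL.continuousOn, fun s hs => ⟨(hL' s).1, ?_⟩⟩
    rw [(hL' s).2, Set.projIcc_of_mem huv hs]
  obtain ⟨τ, hτ0, hτm, ⟨N, hN⟩, hτ⟩ := exists_monotone_Icc_subset_open_cover_Icc hab
    (c := fun t : Set.Icc a b => {s : Set.Icc a b | f s ∈ W t})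
    (fun t => (hWo t t.2).preimage (hf.comp continuous_subtype_val))
    (fun s _ => Set.mem_iUnion.2 ⟨s, hWf s s.2⟩)
  have key (n : ℕ) : ∃ L, IsLiftOn q S f L (Set.Icc a (τ n)) := by
    induction n with
    | zero =>
      refine hsub a (τ 0) (τ 0).2.1 a ⟨le_rfl, hab⟩ fun s hs => ?_
      rw [hτ0, Set.Icc_self] at hs
      rw [hs]
      exact hWf a ⟨le_rfl, hab⟩
    | succ n ih =>
      obtain ⟨L, hL⟩ := ih
      have hle : (τ n : ℝ) ≤ τ (n + 1) := hτm n.le_succ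
      obtain ⟨i, hi⟩ := hτ n
      obtain ⟨L', hL'⟩ := hsub (τ n) (τ (n + 1)) hle i i.2 fun s hs =>
        hi (a := ⟨s, (τ n).2.1.trans hs.1, hs.2.trans (τ (n + 1)).2.2⟩) ⟨hs.1, hs.2⟩
      obtain ⟨L'', h, -⟩ := IsLiftOn.glue htr isClosed_Icc isClosed_Icc (b := (τ n : ℝ))
        ⟨(τ n).2.1, le_rfl⟩ ⟨le_rfl, hle⟩ (fun s hs => le_antisymm hs.1.2 hs.2.1) hL hL'
      refine ⟨L'', ?_⟩
      rwa [Set.Icc_union_Icc_eq_Icc (τ n).2.1 hle] at h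
  have := key N
  rwa [hN N le_rfl] at this

/-- Lifts exist over open intervals as soon as they exist locally. -/
theorem exists_isLiftOn_of_ordConnected (htr : TransitiveOnFibers q S) (hf : Continuous f)
    {J : Set ℝ} (hJ : IsOpen J) (hJc : J.OrdConnected) (hJn : J.Nonempty)
    (hloc : ∀ t ∈ J, ∃ V', IsOpen V' ∧ f t ∈ V' ∧ LiftsPaths q S V') :
    ∃ L, IsLiftOn q S f L J := by
  classical
  obtain ⟨t₀, ht₀⟩ := hJn
  obtain ⟨e, he⟩ := exists_surjective_nat ℚ
  -- An enumeration of the rationals of `J`, with `t₀` in place of those outside `J`. The running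
  -- minima `a` and maxima `b` bound compact intervals that exhaust `J`.
  let r : ℕ → ℝ := fun n => if (e n : ℝ) ∈ J then e n else t₀
  have hr (n) : r n ∈ J := by
    by_cases h : (e n : ℝ) ∈ J <;> simp [r, h, ht₀]
  let a : ℕ → ℝ := fun n => Nat.rec t₀ (fun n x => min x (r n)) n
  let b : ℕ → ℝ := fun n => Nat.rec t₀ (fun n x => max x (r n)) n
  have ha (n) : a (n + 1) = min (a n) (r n) := rfl
  have hb (n) : b (n + 1) = max (b n) (r n) := rfl
  have haJ (n) : a n ∈ J ∧ a n ≤ t₀ := by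
    induction n with
    | zero => exact ⟨ht₀, le_rfl⟩
    | succ n ih =>
      refine ⟨?_, (ha n).trans_le ((min_le_left _ _).trans ih.2)⟩
      rw [ha]
      rcases min_choice (a n) (r n) with h | h <;> rw [h]
      exacts [ih.1, hr n]
  have hbJ (n) : b n ∈ J ∧ t₀ ≤ b n := by
    induction n with
    | zero => exact ⟨ht₀, le_rfl⟩
    | succ n ih =>
      refine ⟨?_, ih.2.trans ((le_max_left _ _).trans (hb n).ge)⟩
      rw [hb]
      rcases max_choice (b n) (r n) with h | h <;> rw [h]
      exacts [ih.1, hr n]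
  have hamono : Antitone a := antitone_nat_of_succ_le fun n => (ha n).trans_le (min_le_left _ _)
  have hbmono : Monotone b := monotone_nat_of_le_succ fun n => (le_max_left _ _).trans (hb n).ge
  have hab (n) : a n ≤ b n := (haJ n).2.trans (hbJ n).2
  have hsub (n) : Set.Icc (a n) (b n) ⊆ J := hJc.out (haJ n).1 (hbJ n).1
  have hex {u v : ℝ} (huv : u ≤ v) (h : Set.Icc u v ⊆ J) :
      ∃ L, IsLiftOn q S f L (Set.Icc u v) :=
    exists_isLiftOn_Icc htr hf huv fun t ht => hloc t (h ht)
  -- The hypothesis on `L` stands under the existential, so that `choose` gives an extension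
  -- operator defined on all functions.
  have hstep (n : ℕ) (L : ℝ → X) : ∃ L', IsLiftOn q S f L (Set.Icc (a n) (b n)) →
      IsLiftOn q S f L' (Set.Icc (a (n + 1)) (b (n + 1))) ∧
        Set.EqOn L' L (Set.Icc (a n) (b n)) := by
    by_cases hL : IsLiftOn q S f L (Set.Icc (a n) (b n))
    swap
    · exact ⟨L, fun h => absurd h hL⟩
    have h1 := hamono n.le_succ
    have h2 := hbmono n.le_succ
    obtain ⟨R, hR⟩ := hex h2 (hJc.out (hbJ n).1 (hbJ (n + 1)).1)
    obtain ⟨R', hR'⟩ := hex h1 (hJc.out (haJ (n + 1)).1 (haJ n).1)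
    obtain ⟨L₁, hL₁, e₁⟩ := IsLiftOn.glue htr isClosed_Icc isClosed_Icc (b := b n)
      ⟨hab n, le_rfl⟩ ⟨le_rfl, h2⟩ (fun s hs => le_antisymm hs.1.2 hs.2.1) hL hR
    rw [Set.Icc_union_Icc_eq_Icc (hab n) h2] at hL₁
    obtain ⟨L₂, hL₂, e₂⟩ := IsLiftOn.glue htr isClosed_Icc isClosed_Icc (b := a n)
      ⟨le_rfl, (hab n).trans h2⟩ ⟨h1, le_rfl⟩ (fun s hs => le_antisymm hs.2.2 hs.1.1) hL₁ hR'
    rw [Set.union_comm, Set.Icc_union_Icc_eq_Icc h1 ((hab n).trans h2)] at hL₂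
    exact ⟨L₂, fun _ => ⟨hL₂, fun s hs => (e₂ ⟨hs.1, hs.2.trans h2⟩).trans (e₁ hs)⟩⟩
  choose next hnext using hstep
  obtain ⟨L₀, hL₀⟩ := hex (hab 0) (hsub 0)
  let Λ : ℕ → ℝ → X := fun n => Nat.rec L₀ (fun n L => next n L) n
  have hΛ (n) : IsLiftOn q S f (Λ n) (Set.Icc (a n) (b n)) := by
    induction n with
    | zero => exact hL₀
    | succ n ih => exact (hnext n _ ih).1
  have hIcc {m n : ℕ} (hmn : m ≤ n) : Set.Icc (a m) (b m) ⊆ Set.Icc (a n) (b n) :=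
    Set.Icc_subset_Icc (hamono hmn) (hbmono hmn)
  have hΛeq {m n : ℕ} (hmn : m ≤ n) : Set.EqOn (Λ n) (Λ m) (Set.Icc (a m) (b m)) := by
    induction n, hmn using Nat.le_induction with
    | base => exact fun _ _ => rfl
    | succ n hmn ih => exact fun s hs => ((hnext n _ (hΛ n)).2 (hIcc hmn hs)).trans (ih hs)
  have hcover (t : ℝ) (ht : t ∈ J) : ∃ n, t ∈ Set.Ioo (a n) (b n) := by
    obtain ⟨ε, hε, hball⟩ := Metric.isOpen_iff.1 hJ t ht
    have hq (x y : ℝ) (hxy : x < y) (hx : t - ε < x) (hy : y < t + ε) :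
        ∃ n, x < r n ∧ r n < y := by
      obtain ⟨c, hc1, hc2⟩ := exists_rat_btwn hxy
      obtain ⟨n, rfl⟩ := he c
      have : (e n : ℝ) ∈ J := hball (by
        rw [Metric.mem_ball, Real.dist_eq, abs_lt]; constructor <;> linarith)
      exact ⟨n, by simpa [r, this] using ⟨hc1, hc2⟩⟩
    obtain ⟨n, -, hn⟩ := hq (t - ε / 2) t (by linarith) (by linarith) (by linarith)
    obtain ⟨m, hm, -⟩ := hq t (t + ε / 2) (by linarith) (by linarith) (by linarith)
    refine ⟨max (n + 1) (m + 1), ?_, ?_⟩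
    · exact ((hamono (le_max_left _ _)).trans ((ha n).trans_le (min_le_right _ _))).trans_lt hn
    · exact hm.trans_le (((le_max_right _ _).trans (hb m).ge).trans
        (hbmono (le_max_right (n + 1) (m + 1))))
  choose! N hN using hcover
  have hfin (n : ℕ) : Set.EqOn (fun t => Λ (N t) t) (Λ n) (Set.Icc (a n) (b n)) := by
    intro t ht
    have htN := Set.Ioo_subset_Icc_self (hN t (hsub n ht))
    rcases le_total n (N t) with h | h
    · exact hΛeq h ht
    · exact (hΛeq h htN).symm
  refine ⟨fun t => Λ (N t) t, fun t ht => ?_, fun t ht => ?_⟩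
  · have := Icc_mem_nhds (hN t ht).1 (hN t ht).2
    exact (((hΛ (N t)).congr (hfin (N t))).1.continuousAt this).continuousWithinAt
  · exact (hΛ (N t)).2 t (Set.Ioo_subset_Icc_self (hN t ht))

/-- Lifts exist over open sets of parameters as soon as they exist locally. -/
theorem exists_isLiftOn_of_isOpen [Nonempty X] (htr : TransitiveOnFibers q S) (hf : Continuous f)
    {O : Set ℝ} (hO : IsOpen O)
    (hloc : ∀ t ∈ O, ∃ V', IsOpen V' ∧ f t ∈ V' ∧ LiftsPaths q S V') :
    ∃ L, IsLiftOn q S f L O := by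
  classical
  rcases O.eq_empty_or_nonempty with rfl | ⟨o, ho⟩
  · exact ⟨fun _ => Classical.arbitrary X, continuousOn_empty _, fun t ht => ht.elim⟩
  have hcomp (t : O) : ∃ L, IsLiftOn q S f L (O.ordConnectedComponent t) := by
    refine exists_isLiftOn_of_ordConnected htr hf ?_ inferInstance ⟨t, ?_⟩ fun s hs =>
      hloc s (Set.ordConnectedComponent_subset hs)
    · rw [isOpen_iff_mem_nhds]
      intro s hs
      rw [Set.ordConnectedComponent_eq (Set.mem_ordConnectedComponent.1 hs)]
      exact Set.ordConnectedComponent_mem_nhds.2 (hO.mem_nhds (Set.ordConnectedComponent_subset hs))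
    · exact Set.self_mem_ordConnectedComponent.2 t.2
  choose Λ hΛ using hcomp
  -- One representative per component, so that nearby parameters use the same lift. The value `o`
  -- outside `O` plays no role.
  let P : ℝ → O := fun t => if h : t ∈ O then ⟨Set.ordConnectedProj O ⟨t, h⟩,
    Set.ordConnectedComponent_subset (Set.ordConnectedProj_mem_ordConnectedComponent O ⟨t, h⟩)⟩
    else ⟨o, ho⟩
  have hP (t : ℝ) (ht : t ∈ O) : t ∈ O.ordConnectedComponent (P t) := by
    simp only [P, dif_pos ht]
    exact Set.mem_ordConnectedComponent_ordConnectedProj O ⟨t, ht⟩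
  have hPeq (t s : ℝ) (hts : s ∈ O.ordConnectedComponent t) : P s = P t := by
    have ht : t ∈ O := Set.ordConnectedComponent_subset (Set.mem_ordConnectedComponent_comm.1 hts)
    have hs : s ∈ O := Set.ordConnectedComponent_subset hts
    simp only [P, dif_pos ht, dif_pos hs, Subtype.mk.injEq]
    rw [Set.ordConnectedProj_eq]
    exact Set.mem_ordConnectedComponent.1 (Set.mem_ordConnectedComponent_comm.1 hts)
  refine ⟨fun t => Λ (P t) t, fun t ht => ContinuousAt.continuousWithinAt ?_, fun t ht =>
    (hΛ (P t)).2 t (hP t ht)⟩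
  have h1 : O.ordConnectedComponent t ∈ 𝓝 t := Set.ordConnectedComponent_mem_nhds.2 (hO.mem_nhds ht)
  have h2 : O.ordConnectedComponent (P t) ∈ 𝓝 t := by
    rw [Set.ordConnectedComponent_eq (Set.mem_ordConnectedComponent.1 (hP t ht))]
    exact h1
  refine ((hΛ (P t)).1.continuousAt h2).congr ?_
  filter_upwards [h1] with s hs
  rw [hPeq t s hs]

/-- Paths lift if, around each point, either paths lift or the fiber does not spread. -/
theorem LiftsPaths.of_local (htr : TransitiveOnFibers q S)
    (hloc : ∀ y ∈ V, (∃ V', IsOpen V' ∧ y ∈ V' ∧ LiftsPaths q S V') ∨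
      ∃ x ∈ S, q x = y ∧ ∀ U ∈ 𝓝 x, ∀ᶠ y' in 𝓝 y, ∀ z ∈ S, q z = y' → z ∈ U) :
    LiftsPaths q S V := by
  classical
  intro f hf hfV
  let O : Set ℝ := {t | ∃ V', IsOpen V' ∧ f t ∈ V' ∧ LiftsPaths q S V'}
  have hO : IsOpen O := by
    rw [isOpen_iff_mem_nhds]
    rintro t ⟨V', hV', htV', h⟩
    filter_upwards [hf.continuousAt.preimage_mem_nhds (hV'.mem_nhds htV')] with s hs
    exact ⟨V', hV', hs, h⟩
  have : Nonempty X := by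
    rcases hloc _ (hfV 0) with ⟨V', -, h0, h⟩ | ⟨x, -⟩
    · obtain ⟨L, -⟩ := h (fun _ => f 0) continuous_const fun _ => h0
      exact ⟨L 0⟩
    · exact ⟨x⟩
  obtain ⟨L, hL⟩ := exists_isLiftOn_of_isOpen htr hf hO fun t ht => ht
  have hfix (t : ℝ) (ht : t ∉ O) : ∃ x ∈ S, q x = f t ∧
      ∀ U ∈ 𝓝 x, ∀ᶠ y' in 𝓝 (f t), ∀ z ∈ S, q z = y' → z ∈ U :=
    (hloc _ (hfV t)).resolve_left ht
  choose! c hcS hcq hc using hfix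
  have hmem (t : ℝ) : (if t ∈ O then L t else c t) ∈ S ∧ q (if t ∈ O then L t else c t) = f t := by
    by_cases ht : t ∈ O
    · simpa [ht] using hL.2 t ht
    · simpa [ht] using ⟨hcS t ht, hcq t ht⟩
  refine ⟨fun t => if t ∈ O then L t else c t, continuous_iff_continuousAt.2 fun t => ?_, hmem⟩
  by_cases ht : t ∈ O
  · refine (hL.1.continuousAt (hO.mem_nhds ht)).congr ?_
    filter_upwards [hO.mem_nhds ht] with s hs
    simp [hs]
  -- Outside `O` the fiber does not spread, so every choice of values over nearby points lies in
  -- `U`.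
  · intro U hU
    simp only [ht, if_false] at hU
    exact (hf.continuousAt.eventually (hc t ht U hU)).mono fun s hs => hs _ (hmem s).1 (hmem s).2

/-- The fibers of a closed map do not spread. -/
theorem _root_.IsClosedMap.eventually_fiber_mem (hq : IsClosedMap q) {C U : Set X}
    (hC : IsClosed C) (hU : IsOpen U) {y : Y} (h : ∀ z ∈ C, q z = y → z ∈ U) :
    ∀ᶠ y' in 𝓝 y, ∀ z ∈ C, q z = y' → z ∈ U := by
  have h1 : IsClosed (q '' (C ∩ Uᶜ)) := hq _ (hC.inter hU.isClosed_compl)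
  have h2 : y ∉ q '' (C ∩ Uᶜ) := by
    rintro ⟨z, hz, rfl⟩
    exact hz.2 (h z hz.1 rfl)
  filter_upwards [h1.isOpen_compl.mem_nhds h2] with y' hy' z hz e
  by_contra hzU
  exact hy' ⟨z, ⟨hz, hzU⟩, e⟩

/-- Paths lift along the quotient by a finite group. -/
theorem LiftsPaths.of_finite {D : Type*} [Group D] [Finite D] [MulAction D X]
    [ContinuousConstSMul D X] [T2Space X] (H : Subgroup D) (S : Set X) (V : Set Y)
    (hq : ∀ h ∈ H, ∀ x ∈ S, q (h • x) = q x) (hV : IsOpen V) (hS : ∀ h ∈ H, ∀ x ∈ S, h • x ∈ S)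
    (hfib : ∀ x ∈ S, ∀ x' ∈ S, q x = q x' → ∃ h ∈ H, h • x = x')
    (hsurj : ∀ y ∈ V, ∃ x ∈ S, q x = y)
    (hcl : ∀ y ∈ V, ∀ U, IsOpen U → (∀ z ∈ S, q z = y → z ∈ U) →
      ∀ᶠ y' in 𝓝 y, ∀ z ∈ S, q z = y' → z ∈ U) :
    LiftsPaths q S V := by
  -- Near a point that `H` does not fix, `H` is replaced by its smaller intersection with the
  -- stabilizer.
  induction hn : Nat.card H using Nat.strong_induction_on generalizing H S V with
  | _ n ih =>
  subst hn
  refine LiftsPaths.of_local (fun x hx x' hx' h => ?_) fun y hy => ?_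
  · obtain ⟨h, hh, e⟩ := hfib x hx x' hx' h
    exact ⟨(h • ·), continuous_const_smul h, fun z hz => ⟨hS h hh z hz, hq h hh z hz⟩, e⟩
  obtain ⟨x, hx, rfl⟩ := hsurj y hy
  by_cases hfix : ∀ h ∈ H, h • x = x
  · refine Or.inr ⟨x, hx, rfl, fun U hU => ?_⟩
    refine (hcl _ hy (interior U) isOpen_interior fun z hz e => ?_).mono fun y' h z hz e =>
      interior_subset (h z hz e)
    obtain ⟨h, hh, rfl⟩ := hfib x hx z hz e.symm
    rw [hfix h hh]
    exact mem_interior_iff_mem_nhds.2 hU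
  left
  push Not at hfix
  obtain ⟨h₀, hh₀, hne⟩ := hfix
  have hlt : Nat.card (H ⊓ MulAction.stabilizer D x : Subgroup D) < Nat.card H := by
    by_contra! hle
    have := Subgroup.eq_of_le_of_card_ge (inf_le_left : H ⊓ MulAction.stabilizer D x ≤ H) hle
    exact hne (this.ge hh₀).2
  obtain ⟨W, hW, hdisj⟩ := (Set.finite_range fun h : D => h • x).t2_separation
  -- The slice: the stabilizer of `x` preserves `U₀`, and an element of `D` carrying a point of `U₀`
  -- into `U₀` must fix `x`.
  let U₀ : Set X := ⋂ h : D, (h • ·) ⁻¹' W (h • x)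
  have hU₀ : IsOpen U₀ := isOpen_iInter_of_finite fun h =>
    (hW _).2.preimage (continuous_const_smul h)
  have hU₀W {z : X} (hz : z ∈ U₀) (h : D) : h • z ∈ W (h • x) := Set.mem_iInter.1 hz h
  have hxU₀ : x ∈ U₀ := Set.mem_iInter.2 fun h => (hW _).1
  have hstab (h : D) (w : X) (hw : w ∈ U₀) (hz : h • w ∈ U₀) : h • x = x := by
    by_contra hne
    refine (hdisj (Set.mem_range_self h) ⟨1, one_smul D x⟩ hne).le_bot
      ⟨hU₀W hw h, ?_⟩
    simpa using hU₀W hz 1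
  have hinv (k : D) (hk : k • x = x) (z : X) (hz : z ∈ U₀) : k • z ∈ U₀ := by
    refine Set.mem_iInter.2 fun h => ?_
    have := hU₀W hz (h * k)
    rwa [mul_smul, mul_smul, hk] at this
  have hopen (h : D) : IsOpen ((h • ·) ⁻¹' U₀) := hU₀.preimage (continuous_const_smul h)
  -- Over a neighborhood of `q x`, every point of the fiber can be moved by `H` into the slice.
  have hev := hcl _ hy (⋃ h : H, ((h : D) • ·) ⁻¹' U₀) (isOpen_iUnion fun h => hopen h)
    fun z hz e => by
      obtain ⟨h, hh, e⟩ := hfib z hz x hx e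
      exact Set.mem_iUnion.2 ⟨⟨h, hh⟩, by simpa [e] using hxU₀⟩
  obtain ⟨V', hV', hV'o, hyV'⟩ := eventually_nhds_iff.1 hev
  refine ⟨V ∩ V', hV.inter hV'o, ⟨hy, hyV'⟩, LiftsPaths.mono
    (ih _ hlt (H ⊓ MulAction.stabilizer D x) (S ∩ U₀) (V ∩ V') ?_ (hV.inter hV'o) ?_ ?_ ?_ ?_ rfl)
    Set.inter_subset_left subset_rfl⟩
  · exact fun h hh z hz => hq h hh.1 z hz.1
  · exact fun h hh z hz => ⟨hS h hh.1 z hz.1, hinv h hh.2 z hz.2⟩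
  · intro z hz z' hz' e
    obtain ⟨h, hh, rfl⟩ := hfib z hz.1 z' hz'.1 e
    exact ⟨h, ⟨hh, hstab h z hz.2 hz'.2⟩, rfl⟩
  · intro y hy'
    obtain ⟨z, hz, rfl⟩ := hsurj y hy'.1
    obtain ⟨h, hh⟩ := Set.mem_iUnion.1 (hV' _ hy'.2 z hz rfl)
    exact ⟨(h : D) • z, ⟨hS h h.2 z hz, hh⟩, hq h h.2 z hz⟩
  · intro y hy' U hU hzU
    -- The translates of the slice by elements not fixing `x` are added to `U` to absorb the rest of
    -- the fiber in `S`; they do not meet `U₀`.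
    have := hcl y hy'.1 (U ∪ ⋃ h : {h : D // h • x ≠ x}, ((h : D) • ·) ⁻¹' U₀)
      (hU.union (isOpen_iUnion fun h => hopen h)) fun z hz e => by
        obtain ⟨h, hh⟩ := Set.mem_iUnion.1 (hV' _ hy'.2 z hz e)
        by_cases hx' : (h : D) • x = x
        · refine Or.inl (hzU z ⟨hz, ?_⟩ e)
          have := hinv (h : D)⁻¹ (by rw [inv_smul_eq_iff, hx']) _ hh
          simpa using this
        · exact Or.inr (Set.mem_iUnion.2 ⟨⟨h, hx'⟩, hh⟩)
    refine this.mono fun y' h z hz e => (h z hz.1 e).resolve_right fun hmem => ?_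
    obtain ⟨⟨h, hne⟩, hh⟩ := Set.mem_iUnion.1 hmem
    exact hne (hstab h z hz.2 hh)

/-- Paths lift to a closed set along a closed map if, around each point, either paths lift or the
fiber is a single point. -/
theorem LiftsPaths.of_isClosed (hq : IsClosedMap q) {C : Set X} (hC : IsClosed C) (hV : IsOpen V)
    (htr : TransitiveOnFibers q (C ∩ q ⁻¹' V))
    (hloc : ∀ y ∈ V, (∃ V', IsOpen V' ∧ y ∈ V' ∧ LiftsPaths q C V') ∨
      ∃ x ∈ C, q x = y ∧ ∀ x' ∈ C, q x' = y → x' = x) :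
    LiftsPaths q C V := by
  refine LiftsPaths.mono (LiftsPaths.of_local htr fun y hy => ?_) Set.inter_subset_left subset_rfl
  rcases hloc y hy with ⟨V', hV', hyV', h⟩ | ⟨x, hx, rfl, h⟩
  · refine Or.inl ⟨V' ∩ V, hV'.inter hV, ⟨hyV', hy⟩, fun f hf hfV => ?_⟩
    obtain ⟨L, hL, hLf⟩ := h f hf fun t => (hfV t).1
    exact ⟨L, hL, fun t => ⟨⟨(hLf t).1, (congrArg (· ∈ V) (hLf t).2).mpr (hfV t).2⟩, (hLf t).2⟩⟩
  · refine Or.inr ⟨x, ⟨hx, hy⟩, rfl, fun U hU => ?_⟩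
    exact (hq.eventually_fiber_mem hC isOpen_interior fun z hz e => by
      rw [h z hz e]
      exact mem_interior_iff_mem_nhds.2 hU).mono fun y' h' z hz e => interior_subset (h' z hz.1 e)

end PathLifting

noncomputable section

/-! ### Tuples of matrices and conjugation -/

section Tuples

open Matrix ComplexConjugate

/-- The group `SL(2, ℂ)`. -/
abbrev SL2C : Type := Matrix.SpecialLinearGroup (Fin 2) ℂ

/-- The compact group `SU(2)`, as a subgroup of `SL(2, ℂ)`. -/
def SU2 : Subgroup SL2C where
  carrier := {g | g.1ᴴ * g.1 = 1}
  mul_mem' {a b} ha hb := by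
    change (a * b).1ᴴ * (a * b).1 = 1
    rw [Matrix.SpecialLinearGroup.coe_mul, conjTranspose_mul, Matrix.mul_assoc, ← Matrix.mul_assoc a.1ᴴ,
      show a.1ᴴ * a.1 = 1 from ha, Matrix.one_mul]
    exact hb
  one_mem' := by simp
  inv_mem' {a} ha := by
    have h1 : a.1 * a⁻¹.1 = 1 := by
      rw [← Matrix.SpecialLinearGroup.coe_mul, mul_inv_cancel, Matrix.SpecialLinearGroup.coe_one]
    have h2 : a.1ᴴ = a⁻¹.1 := left_inv_eq_right_inv ha h1
    change a⁻¹.1ᴴ * a⁻¹.1 = 1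
    rw [← h2, conjTranspose_conjTranspose, h2, h1]

theorem mem_SU2_iff {g : SL2C} : g ∈ SU2 ↔ g.1ᴴ * g.1 = 1 := Iff.rfl

theorem coe_inv_of_mem_SU2 {g : SL2C} (hg : g ∈ SU2) : g⁻¹.1 = g.1ᴴ := by
  refine (left_inv_eq_right_inv (mem_SU2_iff.1 hg) ?_).symm
  rw [← Matrix.SpecialLinearGroup.coe_mul, mul_inv_cancel, Matrix.SpecialLinearGroup.coe_one]

theorem continuous_entry (i j : Fin 2) : Continuous fun g : SL2C => g.1 i j :=
  (continuous_apply_apply i j).comp continuous_subtype_val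

/-- The squared Frobenius norm. -/
def normSqSum (M : Matrix (Fin 2) (Fin 2) ℂ) : ℝ :=
  Complex.normSq (M 0 0) + Complex.normSq (M 0 1) + Complex.normSq (M 1 0) + Complex.normSq (M 1 1)

theorem normSqSum_eq_trace (M : Matrix (Fin 2) (Fin 2) ℂ) :
    (normSqSum M : ℂ) = (Mᴴ * M).trace := by
  simp [normSqSum, Matrix.trace, Matrix.mul_apply, Complex.normSq_eq_conj_mul_self]
  ring

theorem normSqSum_conj {k : SL2C} (hk : k ∈ SU2) (M : Matrix (Fin 2) (Fin 2) ℂ) :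
    normSqSum (k.1 * M * k⁻¹.1) = normSqSum M := by
  have h1 : k⁻¹.1 * k.1 = 1 := by
    rw [← Matrix.SpecialLinearGroup.coe_mul, inv_mul_cancel, Matrix.SpecialLinearGroup.coe_one]
  have : (normSqSum (k.1 * M * k⁻¹.1) : ℂ) = normSqSum M := by
    rw [normSqSum_eq_trace, normSqSum_eq_trace, coe_inv_of_mem_SU2 hk, conjTranspose_mul,
      conjTranspose_mul, conjTranspose_conjTranspose]
    rw [show k.1 * (Mᴴ * k.1ᴴ) * (k.1 * M * k.1ᴴ) = k.1 * (Mᴴ * (k.1ᴴ * k.1) * M * k.1ᴴ) by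
      simp only [Matrix.mul_assoc], mem_SU2_iff.1 hk, Matrix.mul_one, Matrix.trace_mul_comm,
      Matrix.mul_assoc, mem_SU2_iff.1 hk, Matrix.mul_one]
  exact_mod_cast this

theorem continuous_normSqSum : Continuous fun g : SL2C => normSqSum g.1 := by
  have h (i j) := Complex.continuous_normSq.comp (continuous_entry i j)
  exact (((h 0 0).add (h 0 1)).add (h 1 0)).add (h 1 1)

theorem isCompact_normSqSum_le (c : ℝ) : IsCompact {g : SL2C | normSqSum g.1 ≤ c} := by
  have hemb : IsClosedEmbedding (Subtype.val : SL2C → (Fin 2 → Fin 2 → ℂ)) := by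
    refine IsClosed.isClosedEmbedding_subtypeVal ?_
    exact isClosed_eq (Continuous.matrix_det (A := fun x : Matrix (Fin 2) (Fin 2) ℂ => x)
      continuous_id) continuous_const
  refine (hemb.isCompact_preimage
    (isCompact_closedBall (0 : Fin 2 → Fin 2 → ℂ) (max c 0).sqrt)).of_isClosed_subset
    (isClosed_le continuous_normSqSum continuous_const) fun g hg => ?_
  have hg' : normSqSum g.1 ≤ max c 0 := le_trans hg (le_max_left _ _)
  refine mem_closedBall_zero_iff.2 ?_
  refine (pi_norm_le_iff_of_nonneg (Real.sqrt_nonneg _)).2 fun i =>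
    (pi_norm_le_iff_of_nonneg (Real.sqrt_nonneg _)).2 fun j => Real.le_sqrt_of_sq_le ?_
  rw [← Complex.normSq_eq_norm_sq]
  refine le_trans ?_ hg'
  have h00 := Complex.normSq_nonneg (g.1 0 0)
  have h01 := Complex.normSq_nonneg (g.1 0 1)
  have h10 := Complex.normSq_nonneg (g.1 1 0)
  have h11 := Complex.normSq_nonneg (g.1 1 1)
  unfold normSqSum
  fin_cases i <;> fin_cases j <;> simp <;> linarith

instance : CompactSpace SU2 := by
  refine isCompact_iff_compactSpace.1 ((isCompact_normSqSum_le 2).of_isClosed_subset ?_ ?_)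
  · exact isClosed_eq ((Continuous.matrix_conjTranspose continuous_subtype_val).matrix_mul
      continuous_subtype_val) continuous_const
  · intro g hg
    have : (normSqSum g.1 : ℂ) = 2 := by
      rw [normSqSum_eq_trace, mem_SU2_iff.1 hg]
      simp
    exact le_of_eq (by exact_mod_cast this)

/-- Tuples of elements of `SL(2, ℂ)`. -/
def Tuple (n : ℕ) : Type := Fin n → SL2C

instance (n : ℕ) : TopologicalSpace (Tuple n) := inferInstanceAs (TopologicalSpace (Fin n → SL2C))

instance (n : ℕ) : T2Space (Tuple n) := inferInstanceAs (T2Space (Fin n → SL2C))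

variable {n : ℕ}

theorem continuous_tuple_apply (i : Fin n) : Continuous fun A : Tuple n => A i := continuous_apply i

/-- The action of `SL(2, ℂ)` on tuples by conjugation. -/
instance : MulAction SL2C (Tuple n) where
  smul g A := fun i => g * A i * g⁻¹
  one_smul A := funext fun i => by change 1 * A i * 1⁻¹ = A i; group
  mul_smul g h A := funext fun i => by
    change (g * h) * A i * (g * h)⁻¹ = g * (h * A i * h⁻¹) * g⁻¹
    group

theorem conj_smul_apply (g : SL2C) (A : Tuple n) (i : Fin n) : (g • A) i = g * A i * g⁻¹ := rfl

instance : ContinuousSMul SL2C (Tuple n) where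
  continuous_smul := continuous_pi fun i =>
    (continuous_fst.mul ((continuous_tuple_apply i).comp continuous_snd)).mul continuous_fst.inv

/-- Tuples of central elements of `SL(2, ℂ)`. -/
abbrev Signs (n : ℕ) : Type := Fin n → Subgroup.center SL2C

/-- The action of central elements on tuples. -/
instance : MulAction (Signs n) (Tuple n) where
  smul z A := fun i => (z i : SL2C) * A i
  one_smul A := funext fun i => one_mul (A i)
  mul_smul z w A := funext fun i => mul_assoc (z i : SL2C) (w i) (A i)

theorem signs_smul_apply (z : Signs n) (A : Tuple n) (i : Fin n) : (z • A) i = z i * A i := rfl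

instance : ContinuousConstSMul (Signs n) (Tuple n) where
  continuous_const_smul _ := continuous_pi fun i => continuous_const.mul (continuous_tuple_apply i)

theorem center_comm (z : Subgroup.center SL2C) (g : SL2C) : g * z = z * g :=
  Subgroup.mem_center_iff.1 z.2 g

instance : SMulCommClass (Signs n) SL2C (Tuple n) where
  smul_comm z g A := funext fun i => by
    change (z i : SL2C) * (g * A i * g⁻¹) = g * (z i * A i) * g⁻¹
    rw [← mul_assoc g, center_comm]
    simp only [mul_assoc]

instance : Finite (Subgroup.center SL2C) :=
  have : NeZero (max (Fintype.card (Fin 2)) 1) := ⟨by simp⟩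
  Finite.of_equiv _ (Matrix.SpecialLinearGroup.center_equiv_rootsOfUnity (n := Fin 2) (R := ℂ)).symm.toEquiv

theorem normSqSum_center_mul (z : Subgroup.center SL2C) (g : SL2C) :
    normSqSum ((z : SL2C) * g).1 = normSqSum g.1 := by
  obtain ⟨r, hr, hz⟩ := Matrix.SpecialLinearGroup.mem_center_iff.1 z.2
  have hr1 : Complex.normSq r = 1 := by
    have : ‖r‖ = 1 := by
      have := congrArg norm hr
      rw [norm_pow, norm_one, Fintype.card_fin] at this
      exact (pow_eq_one_iff_of_nonneg (norm_nonneg _) two_ne_zero).1 this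
    rw [Complex.normSq_eq_norm_sq, this, one_pow]
  rw [Matrix.SpecialLinearGroup.coe_mul, ← hz]
  simp [normSqSum, hr1]

/-- The sum of the squared Frobenius norms. -/
def energy (A : Tuple n) : ℝ := ∑ i, normSqSum (A i).1

theorem continuous_energy : Continuous (energy (n := n)) :=
  continuous_finsetSum _ fun i _ => continuous_normSqSum.comp (continuous_tuple_apply i)

theorem normSqSum_nonneg (M : Matrix (Fin 2) (Fin 2) ℂ) : 0 ≤ normSqSum M := by
  have h (i j) := Complex.normSq_nonneg (M i j)
  exact add_nonneg (add_nonneg (add_nonneg (h 0 0) (h 0 1)) (h 1 0)) (h 1 1)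

theorem isCompact_energy_le (c : ℝ) : IsCompact {A : Tuple n | energy A ≤ c} := by
  refine (isCompact_univ_pi fun _ : Fin n => isCompact_normSqSum_le c).of_isClosed_subset
    (isClosed_le continuous_energy continuous_const) fun A hA i _ => ?_
  exact (Finset.single_le_sum (f := fun i => normSqSum (A i).1) (fun i _ => normSqSum_nonneg _)
    (Finset.mem_univ i)).trans hA

theorem energy_signs_smul (z : Signs n) (A : Tuple n) : energy (z • A) = energy A :=
  Finset.sum_congr rfl fun i _ => normSqSum_center_mul (z i) (A i)

theorem energy_smul_of_mem_SU2 {k : SL2C} (hk : k ∈ SU2) (A : Tuple n) :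
    energy (k • A) = energy A :=
  Finset.sum_congr rfl fun i _ => by
    rw [conj_smul_apply, Matrix.SpecialLinearGroup.coe_mul, Matrix.SpecialLinearGroup.coe_mul, normSqSum_conj hk]

/-- Hermitian matrices are diagonalized by `SU(2)`, with decreasing eigenvalues. -/
theorem exists_SU2_diagonal {H : Matrix (Fin 2) (Fin 2) ℂ} (hH : H.IsHermitian) :
    ∃ k ∈ SU2, ∃ x y : ℝ, y ≤ x ∧ k.1 * H * k.1ᴴ = diagonal ![(x : ℂ), y] := by
  -- A unitary matrix is multiplied by a unit `c` whose square is the conjugate of its determinant;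
  -- such a scalar cancels in conjugation.
  have hU (U : Matrix (Fin 2) (Fin 2) ℂ) (hU : U * Uᴴ = 1) :
      ∃ k ∈ SU2, ∃ c : ℂ, conj c * c = 1 ∧ k.1 = c • U := by
    have hd : U.det * conj U.det = 1 := by
      have := congrArg Matrix.det hU
      rwa [det_mul, det_conjTranspose, det_one] at this
    obtain ⟨c, hc⟩ := IsAlgClosed.exists_pow_nat_eq (conj U.det) (n := 2) (by norm_num)
    have hc1 : conj c * c = 1 := by
      have h1 : ‖conj U.det‖ = 1 := by
        have : ‖U.det‖ * ‖U.det‖ = 1 := by simpa using congrArg norm hd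
        rw [RCLike.norm_conj]
        nlinarith [norm_nonneg U.det]
      have h2 : ‖c‖ = 1 := by
        rw [← hc, norm_pow] at h1
        exact (pow_eq_one_iff_of_nonneg (norm_nonneg _) two_ne_zero).1 h1
      rw [← Complex.normSq_eq_conj_mul_self, Complex.normSq_eq_norm_sq, h2]
      simp
    refine ⟨⟨c • U, ?_⟩, ?_, c, hc1, rfl⟩
    · rw [det_smul, Fintype.card_fin, hc, mul_comm, hd]
    · change (c • U)ᴴ * (c • U) = 1
      rw [conjTranspose_smul, smul_mul_smul, mul_eq_one_comm.1 hU]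
      simp [hc1]
  have hU' (U : Matrix (Fin 2) (Fin 2) ℂ) (hUU : U * Uᴴ = 1) (x y : ℝ) (hxy : y ≤ x)
      (e : U * H * Uᴴ = diagonal ![(x : ℂ), y]) :
      ∃ k ∈ SU2, ∃ x y : ℝ, y ≤ x ∧ k.1 * H * k.1ᴴ = diagonal ![(x : ℂ), y] := by
    obtain ⟨k, hk, c, hc, e'⟩ := hU U hUU
    refine ⟨k, hk, x, y, hxy, ?_⟩
    rw [e', conjTranspose_smul, Matrix.smul_mul, Matrix.smul_mul, Matrix.mul_smul, smul_smul, e]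
    simp [mul_comm c, hc]
  set U := (hH.eigenvectorUnitary : Matrix (Fin 2) (Fin 2) ℂ)
  have h1 : Uᴴ * U = 1 := Unitary.coe_star_mul_self hH.eigenvectorUnitary
  have h2 : H = U * diagonal (RCLike.ofReal ∘ hH.eigenvalues) * Uᴴ := by
    conv_lhs => rw [hH.spectral_theorem]
    simp [Unitary.conjStarAlgAut_apply, U]
    rfl
  have h3 : Uᴴ * H * Uᴴᴴ = diagonal ![(hH.eigenvalues 0 : ℂ), (hH.eigenvalues 1 : ℂ)] := by
    have : (RCLike.ofReal ∘ hH.eigenvalues : Fin 2 → ℂ) =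
        ![(hH.eigenvalues 0 : ℂ), (hH.eigenvalues 1 : ℂ)] := by
      ext i; fin_cases i <;> rfl
    rw [← this]
    conv_lhs => rw [h2]
    rw [conjTranspose_conjTranspose]
    simp only [Matrix.mul_assoc, h1, Matrix.mul_one]
    rw [← Matrix.mul_assoc, h1, Matrix.one_mul]
  rcases le_total (hH.eigenvalues 1) (hH.eigenvalues 0) with h | h
  · exact hU' Uᴴ (by simpa using h1) _ _ h h3
  -- The permutation matrix puts the eigenvalues in decreasing order.
  · refine hU' (!![0, 1; 1, 0] * Uᴴ) ?_ _ _ h ?_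
    · rw [conjTranspose_mul, conjTranspose_conjTranspose, Matrix.mul_assoc, ← Matrix.mul_assoc Uᴴ,
        h1]
      ext i j; fin_cases i <;> fin_cases j <;> simp [Matrix.mul_apply]
    · rw [conjTranspose_mul, Matrix.mul_assoc, Matrix.mul_assoc, ← Matrix.mul_assoc H,
        ← Matrix.mul_assoc Uᴴ, ← Matrix.mul_assoc Uᴴ, h3]
      ext i j; fin_cases i <;> fin_cases j <;> simp [Matrix.mul_apply]

end Tuples

/-! ### Lifting paths along the quotient by `SU(2)` -/

section SU2Quotient

open Matrix ComplexConjugate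

variable {n : ℕ}

/-- The space of `SU(2)`-orbits of tuples. -/
abbrev OrbitSpace (n : ℕ) : Type := Quotient (MulAction.orbitRel SU2 (Tuple n))

/-- The `SU(2)`-orbit of a tuple. -/
def toOrbit (A : Tuple n) : OrbitSpace n := Quotient.mk _ A

theorem toOrbit_eq_iff {A B : Tuple n} : toOrbit A = toOrbit B ↔ ∃ k ∈ SU2, k • A = B := by
  rw [eq_comm]
  refine Quotient.eq.trans (Iff.trans MulAction.orbitRel_apply ?_)
  exact ⟨fun ⟨k, hk⟩ => ⟨k, k.2, hk⟩, fun ⟨k, hk, h⟩ => ⟨⟨k, hk⟩, h⟩⟩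

theorem toOrbit_smul {k : SL2C} (hk : k ∈ SU2) (A : Tuple n) : toOrbit (k • A) = toOrbit A :=
  (toOrbit_eq_iff.2 ⟨k, hk, rfl⟩).symm

theorem toOrbit_surjective : Function.Surjective (toOrbit (n := n)) := Quotient.mk_surjective

theorem continuous_toOrbit : Continuous (toOrbit (n := n)) := continuous_quot_mk

theorem isClosedMap_toOrbit : IsClosedMap (toOrbit (n := n)) :=
  MulAction.isClosedMap_quotient (α := SU2) (β := Tuple n)

theorem isOpenQuotientMap_toOrbit : IsOpenQuotientMap (toOrbit (n := n)) :=
  MulAction.isOpenQuotientMap_quotientMk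

/-- Actions of compact groups are proper. `LiftsPaths.of_finite` needs this separation to find
slices for the signs acting on orbits. -/
instance : T2Space (OrbitSpace n) := by
  have : ProperSMul SU2 (Tuple n) := by
    rw [properSMul_iff_continuousSMul_ultrafilter_tendsto_t2]
    refine ⟨inferInstance, fun 𝒰 _ _ _ => ?_⟩
    obtain ⟨g, -, hg⟩ := isCompact_univ.ultrafilter_le_nhds (𝒰.map Prod.fst)
      (le_principal_iff.2 univ_mem)
    exact ⟨g, hg⟩
  infer_instance

theorem normSq_entry_of_diagonal {k : SL2C} (hk : k ∈ SU2) (h01 : k.1 0 1 = 0) (h10 : k.1 1 0 = 0)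
    (a : Fin 2) : k.1 a a * conj (k.1 a a) = 1 := by
  have h := congrFun (congrFun (mem_SU2_iff.1 hk) a) a
  rw [mul_comm]
  fin_cases a <;> simpa [Matrix.mul_apply, h01, h10] using h

theorem conj_entry_of_diagonal {k : SL2C} (h01 : k.1 0 1 = 0) (h10 : k.1 1 0 = 0)
    (M : Matrix (Fin 2) (Fin 2) ℂ) (a b : Fin 2) :
    (k.1 * M * k.1ᴴ) a b = k.1 a a * M a b * conj (k.1 b b) := by
  fin_cases a <;> fin_cases b <;> simp [Matrix.mul_apply, h01, h10]

theorem smul_val {k : SL2C} (hk : k ∈ SU2) (A : Tuple n) (i : Fin n) :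
    ((k • A) i).1 = k.1 * (A i).1 * k.1ᴴ := by
  rw [conj_smul_apply, Matrix.SpecialLinearGroup.coe_mul, Matrix.SpecialLinearGroup.coe_mul, coe_inv_of_mem_SU2 hk]

/-! ### Slices for the conjugation action of SU(2) -/

/-- The Hermitian matrix `c M + (c M)ᴴ`. -/
def herm (c : ℂ) (M : Matrix (Fin 2) (Fin 2) ℂ) : Matrix (Fin 2) (Fin 2) ℂ :=
  c • M + conj c • Mᴴ

theorem herm_apply (c : ℂ) (M : Matrix (Fin 2) (Fin 2) ℂ) (a b : Fin 2) :
    herm c M a b = c * M a b + conj c * conj (M b a) := by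
  simp [herm]

theorem isHermitian_herm (c : ℂ) (M : Matrix (Fin 2) (Fin 2) ℂ) : (herm c M).IsHermitian := by
  ext a b
  simp [herm, add_comm]

theorem herm_conj (c : ℂ) (M k : Matrix (Fin 2) (Fin 2) ℂ) :
    herm c (k * M * kᴴ) = k * herm c M * kᴴ := by
  simp [herm, Matrix.mul_add, Matrix.add_mul, Matrix.mul_assoc]

theorem continuous_herm (c : ℂ) (i : Fin n) (a b : Fin 2) :
    Continuous fun A : Tuple n => herm c (A i).1 a b := by
  have h (a b) : Continuous fun A : Tuple n => (A i).1 a b :=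
    (continuous_entry a b).comp (continuous_tuple_apply i)
  simp only [herm_apply]
  exact (continuous_const.mul (h a b)).add
    (continuous_const.mul (Complex.continuous_conj.comp (h b a)))

/-- A `2 × 2` matrix is scalar. -/
def IsScalar (M : Matrix (Fin 2) (Fin 2) ℂ) : Prop := M 0 1 = 0 ∧ M 1 0 = 0 ∧ M 0 0 = M 1 1

theorem isScalar_iff {M : Matrix (Fin 2) (Fin 2) ℂ} :
    IsScalar M ↔ M = M 0 0 • (1 : Matrix (Fin 2) (Fin 2) ℂ) := by
  refine ⟨fun ⟨h1, h2, h3⟩ => ?_, fun h => ⟨?_, ?_, ?_⟩⟩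
  · ext a b; fin_cases a <;> fin_cases b <;> simp [h1, h2, h3]
  all_goals rw [h]; simp

theorem IsScalar.conj {M : Matrix (Fin 2) (Fin 2) ℂ} (h : IsScalar M) {k : SL2C} (hk : k ∈ SU2) :
    k.1 * M * k.1ᴴ = M := by
  rw [isScalar_iff.1 h]
  simp [mul_eq_one_comm.1 (mem_SU2_iff.1 hk)]

/-- The values `c = 1` and `c = I` give M + Mᴴ and I(M - Mᴴ), from which M is recovered linearly.
Thus a tuple that is not scalar has a Hermitian combination that can be diagonalized with distinct
eigenvalues. -/
theorem isScalar_of_herm {M : Matrix (Fin 2) (Fin 2) ℂ} (h : ∀ c, IsScalar (herm c M)) :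
    IsScalar M := by
  have h1 := h 1
  have h2 := h Complex.I
  simp only [IsScalar, herm_apply, map_one, one_mul, Complex.conj_I] at h1 h2
  obtain ⟨a1, a2, a3⟩ := h1
  obtain ⟨b1, b2, b3⟩ := h2
  refine ⟨?_, ?_, ?_⟩
  · linear_combination (1 / 2 : ℂ) * a1 - (Complex.I / 2) * b1 +
      (1 / 2) * (M 0 1 - conj (M 1 0)) * Complex.I_sq
  · linear_combination (1 / 2 : ℂ) * a2 - (Complex.I / 2) * b2 +
      (1 / 2) * (M 1 0 - conj (M 0 1)) * Complex.I_sq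
  · linear_combination (1 / 2 : ℂ) * a3 - (Complex.I / 2) * b3 +
      (1 / 2) * ((M 0 0 - conj (M 0 0)) - (M 1 1 - conj (M 1 1))) * Complex.I_sq

/-- The tuples for which a given Hermitian matrix is diagonal, with decreasing eigenvalues. -/
def diagonalSlice (c : ℂ) (i : Fin n) : Set (Tuple n) :=
  {A | herm c (A i).1 0 1 = 0 ∧ herm c (A i).1 1 0 = 0 ∧
    (herm c (A i).1 1 1).re ≤ (herm c (A i).1 0 0).re}

theorem isClosed_diagonalSlice (c : ℂ) (i : Fin n) : IsClosed (diagonalSlice c i) :=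
  (isClosed_eq (continuous_herm c i 0 1) continuous_const).inter
    ((isClosed_eq (continuous_herm c i 1 0) continuous_const).inter
      (isClosed_le (Complex.continuous_re.comp (continuous_herm c i 1 1))
        (Complex.continuous_re.comp (continuous_herm c i 0 0))))

theorem exists_mem_diagonalSlice (c : ℂ) (i : Fin n) (A : Tuple n) :
    ∃ k ∈ SU2, k • A ∈ diagonalSlice c i := by
  obtain ⟨k, hk, x, y, hxy, e⟩ := exists_SU2_diagonal (isHermitian_herm c (A i).1)
  refine ⟨k, hk, ?_⟩
  simp only [diagonalSlice, Set.mem_ofPred_eq, smul_val hk, herm_conj, e]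
  simpa using hxy

/-- Elements of `SU(2)` exchanging points of the slice are diagonal. -/
theorem diagonal_of_mem_diagonalSlice {c : ℂ} {i : Fin n} {A : Tuple n} (hA : A ∈ diagonalSlice c i)
    (hs : ¬ IsScalar (herm c (A i).1)) {k : SL2C} (hk : k ∈ SU2) (hkA : k • A ∈ diagonalSlice c i) :
    k.1 0 1 = 0 ∧ k.1 1 0 = 0 := by
  obtain ⟨h1, h2, h3⟩ := hA
  simp only [diagonalSlice, Set.mem_ofPred_eq, smul_val hk, herm_conj] at hkA
  have hH := isHermitian_herm c (A i).1
  generalize herm c (A i).1 = H at *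
  set K := k.1 * H * k.1ᴴ with hK
  obtain ⟨h1', h2', h3'⟩ := hkA
  have hcomm : K * k.1 = k.1 * H := by
    rw [hK, Matrix.mul_assoc, mem_SU2_iff.1 hk, Matrix.mul_one]
  have e01 := congrFun (congrFun hcomm 0) 1
  have e10 := congrFun (congrFun hcomm 1) 0
  simp only [Matrix.mul_apply, Fin.sum_univ_two, h1, h2, h1', h2', zero_mul, mul_zero, add_zero,
    zero_add] at e01 e10
  have him (a : Fin 2) : (H a a).im = 0 := Complex.conj_eq_iff_im.1 (hH.apply a a)
  have hdet : k.1 0 0 * k.1 1 1 - k.1 0 1 * k.1 1 0 = 1 := by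
    rw [← det_fin_two]; exact k.2
  have horth : conj (k.1 0 0) * k.1 0 1 + conj (k.1 1 0) * k.1 1 1 = 0 := by
    simpa [Matrix.mul_apply] using congrFun (congrFun (mem_SU2_iff.1 hk) 0) 1
  have hiff : k.1 0 1 = 0 ↔ k.1 1 0 = 0 := by
    constructor <;> intro h <;> rw [h] at horth hdet
    · by_contra hne
      simp [hne] at horth
      simp [horth] at hdet
    · by_contra hne
      simp [hne] at horth
      simp [horth] at hdet
  by_cases h0 : k.1 0 1 = 0
  · exact ⟨h0, hiff.1 h0⟩
  -- With nonzero off-diagonal entries, `k` would exchange the two eigenvalues. Both pairs being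
  -- ordered, they would be equal and `H` scalar.
  · have h0' : k.1 1 0 ≠ 0 := fun h => h0 (hiff.2 h)
    have e1 : K 0 0 = H 1 1 := mul_right_cancel₀ h0 (e01.trans (mul_comm _ _))
    have e2 : K 1 1 = H 0 0 := mul_right_cancel₀ h0' (e10.trans (mul_comm _ _))
    rw [e1, e2] at h3'
    exact absurd ⟨h1, h2, Complex.ext (le_antisymm h3' h3) ((him 0).trans (him 1).symm)⟩ hs

theorem mem_diagonalSlice_of_diagonal {c : ℂ} {i : Fin n} {A : Tuple n} (hA : A ∈ diagonalSlice c i)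
    {k : SL2C} (hk : k ∈ SU2) (h01 : k.1 0 1 = 0) (h10 : k.1 1 0 = 0) :
    k • A ∈ diagonalSlice c i := by
  obtain ⟨h1, h2, h3⟩ := hA
  have hd (a : Fin 2) (z : ℂ) : k.1 a a * z * conj (k.1 a a) = z := by
    rw [mul_right_comm, normSq_entry_of_diagonal hk h01 h10, one_mul]
  refine ⟨?_, ?_, ?_⟩ <;>
    simp only [smul_val hk, herm_conj, conj_entry_of_diagonal h01 h10, h1, h2, hd, mul_zero,
      zero_mul, h3]

/-- The diagonal matrix with entries u and its conjugate multiplies the upper right entry by u² and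
the lower left one by the conjugate of u², so half the argument is taken. -/
theorem exists_rotation {z : ℂ} {a b : Fin 2} (hab : a ≠ b) :
    ∃ k ∈ SU2, k.1 0 1 = 0 ∧ k.1 1 0 = 0 ∧
      (k.1 a a * z * conj (k.1 b b)).im = 0 ∧ 0 ≤ (k.1 a a * z * conj (k.1 b b)).re := by
  have key (w : ℂ) : ∃ u : ℂ, conj u * u = 1 ∧ u * w * u = ‖w‖ := by
    refine ⟨Complex.exp (-(w.arg / 2 * Complex.I)), ?_, ?_⟩
    · have h2 : (conj (2 : ℂ)) = 2 := map_ofNat _ 2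
      rw [← Complex.exp_conj, ← Complex.exp_add]
      simp [h2]
    · have h := Complex.norm_mul_exp_arg_mul_I w
      set v := Complex.exp (-(w.arg / 2 * Complex.I))
      have hv : v * v * Complex.exp (w.arg * Complex.I) = 1 := by
        rw [← Complex.exp_add, ← Complex.exp_add, ← Complex.exp_zero]
        ring_nf
      calc v * w * v = v * (‖w‖ * Complex.exp (w.arg * Complex.I)) * v := by rw [h]
        _ = ‖w‖ * (v * v * Complex.exp (w.arg * Complex.I)) := by ring
        _ = ‖w‖ := by rw [hv, mul_one]
  have hmk (u : ℂ) (hu : conj u * u = 1) : ∃ k ∈ SU2, k.1 = !![u, 0; 0, conj u] := by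
    refine ⟨⟨!![u, 0; 0, conj u], by simpa [det_fin_two, mul_comm] using hu⟩, ?_, rfl⟩
    change (!![u, 0; 0, conj u])ᴴ * !![u, 0; 0, conj u] = 1
    ext i j
    fin_cases i <;> fin_cases j <;> simp [Matrix.mul_apply, hu, mul_comm u]
  obtain ⟨rfl, rfl⟩ | ⟨rfl, rfl⟩ : (a = 0 ∧ b = 1) ∨ (a = 1 ∧ b = 0) := by
    fin_cases a <;> fin_cases b <;> simp_all
  · obtain ⟨u, hu, e⟩ := key z
    obtain ⟨k, hk, e'⟩ := hmk u hu
    refine ⟨k, hk, ?_⟩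
    simp [e', e]
  · obtain ⟨u, hu, e⟩ := key (conj z)
    obtain ⟨k, hk, e'⟩ := hmk u hu
    have e2 : conj u * z * conj u = ‖z‖ := by
      have := congrArg conj e
      simpa using this
    refine ⟨k, hk, ?_⟩
    simp [e', e2]

theorem smul_eq_self_of_diagonal {k : SL2C} (hk : k ∈ SU2) (h01 : k.1 0 1 = 0) (h10 : k.1 1 0 = 0)
    {A : Tuple n} (hA : ∀ i a b, a ≠ b → k.1 a a * (A i).1 a b * conj (k.1 b b) = (A i).1 a b) :
    k • A = A := by
  funext i
  refine Subtype.ext ?_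
  rw [smul_val hk]
  ext a b
  rw [conj_entry_of_diagonal h01 h10]
  by_cases hab : a = b
  · subst hab
    rw [mul_right_comm, normSq_entry_of_diagonal hk h01 h10, one_mul]
  · exact hA i a b hab

/-- Paths lift to the slice normalizing, moreover, an off-diagonal entry to be positive. -/
theorem liftsPaths_positiveSlice {c : ℂ} {i j : Fin n} {a b : Fin 2} (hab : a ≠ b)
    {V : Set (OrbitSpace n)} (hV : IsOpen V)
    (hs : ∀ A : Tuple n, toOrbit A ∈ V → ¬ IsScalar (herm c (A i).1))
    (hne : ∀ A ∈ diagonalSlice c i, toOrbit A ∈ V → (A j).1 a b ≠ 0) :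
    LiftsPaths toOrbit (diagonalSlice c i) V := by
  set P : Set (Tuple n) := {A | ((A j).1 a b).im = 0 ∧ 0 ≤ ((A j).1 a b).re}
  have hcont : Continuous fun A : Tuple n => (A j).1 a b :=
    (continuous_entry a b).comp (continuous_tuple_apply j)
  have hP : IsClosed P := (isClosed_eq (Complex.continuous_im.comp hcont) continuous_const).inter
    (isClosed_le continuous_const (Complex.continuous_re.comp hcont))
  have huniq : ∀ A ∈ diagonalSlice c i ∩ P, toOrbit A ∈ V → ∀ B ∈ diagonalSlice c i ∩ P,
      toOrbit A = toOrbit B → B = A := by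
    rintro A ⟨hA, hAP⟩ hAV B ⟨hB, hBP⟩ h
    obtain ⟨k, hk, rfl⟩ := toOrbit_eq_iff.1 h
    obtain ⟨h01, h10⟩ := diagonal_of_mem_diagonalSlice hA (hs A hAV) hk hB
    have hA0 := hne A hA hAV
    have hd := normSq_entry_of_diagonal hk h01 h10
    simp only [P, Set.mem_ofPred_eq, smul_val hk, conj_entry_of_diagonal h01 h10] at hBP hAP
    have hpos {w : ℂ} (hw : w.im = 0 ∧ 0 ≤ w.re) : w = ‖w‖ := by
      have : w = (w.re : ℂ) := Complex.ext rfl (by simp [hw.1])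
      rw [this, Complex.norm_real, Real.norm_of_nonneg hw.2]
    have hn (a : Fin 2) : ‖k.1 a a‖ = 1 := by
      have := congrArg norm (hd a)
      rw [norm_mul, RCLike.norm_conj, norm_one] at this
      nlinarith [norm_nonneg (k.1 a a)]
    -- Both sides are nonnegative reals of the same modulus. As the entry is nonzero, `k` has equal
    -- diagonal entries and acts trivially.
    have e : k.1 a a * (A j).1 a b * conj (k.1 b b) = (A j).1 a b := by
      rw [hpos hBP, norm_mul, norm_mul, RCLike.norm_conj, hn, hn, one_mul, mul_one, ← hpos hAP]
    have e' : k.1 a a * conj (k.1 b b) = 1 := by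
      refine mul_right_cancel₀ hA0 ?_
      rw [one_mul, mul_right_comm, e]
    have e'' : k.1 a a = k.1 b b := by
      calc k.1 a a = k.1 a a * (k.1 b b * conj (k.1 b b)) := by rw [hd, mul_one]
        _ = k.1 b b * (k.1 a a * conj (k.1 b b)) := by ring
        _ = k.1 b b := by rw [e', mul_one]
    have h01' : k.1 0 0 = k.1 1 1 := by
      obtain ⟨rfl, rfl⟩ | ⟨rfl, rfl⟩ : (a = 0 ∧ b = 1) ∨ (a = 1 ∧ b = 0) := by
        clear * - hab
        fin_cases a <;> fin_cases b <;> simp_all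
      exacts [e'', e''.symm]
    have hall (x y : Fin 2) : k.1 x x = k.1 y y := by
      fin_cases x <;> fin_cases y <;> first | rfl | exact h01' | exact h01'.symm
    refine smul_eq_self_of_diagonal hk h01 h10 fun l x y _ => ?_
    rw [mul_right_comm, hall x y, hd, one_mul]
  refine LiftsPaths.mono (LiftsPaths.of_isClosed isClosedMap_toOrbit
    ((isClosed_diagonalSlice c i).inter hP) hV (fun A hA B hB h => ?_) fun y hy => Or.inr ?_)
    Set.inter_subset_left subset_rfl
  · exact ⟨id, continuous_id, fun z hz => ⟨hz, rfl⟩, (huniq A hA.1 hA.2 B hB.1 h).symm⟩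
  · obtain ⟨A, rfl⟩ := toOrbit_surjective y
    obtain ⟨k, hk, hkA⟩ := exists_mem_diagonalSlice c i A
    obtain ⟨k', hk', h01, h10, hp⟩ := exists_rotation (z := ((k • A) j).1 a b) hab
    have hm : k' • k • A ∈ diagonalSlice c i ∩ P := by
      refine ⟨mem_diagonalSlice_of_diagonal hkA hk' h01 h10, ?_⟩
      simpa only [P, Set.mem_ofPred_eq, smul_val hk', conj_entry_of_diagonal h01 h10] using hp
    have ho : toOrbit (k' • k • A) = toOrbit A := by rw [toOrbit_smul hk', toOrbit_smul hk]
    refine ⟨k' • k • A, hm, ho, fun B hB h => ?_⟩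
    exact huniq _ hm (by rwa [ho]) B hB (ho.trans h.symm)

/-- Paths lift to the slice diagonalizing a non-scalar Hermitian matrix. -/
theorem liftsPaths_diagonalSlice {c : ℂ} {i : Fin n} {V : Set (OrbitSpace n)} (hV : IsOpen V)
    (hs : ∀ A : Tuple n, toOrbit A ∈ V → ¬ IsScalar (herm c (A i).1)) :
    LiftsPaths toOrbit (diagonalSlice c i) V := by
  refine LiftsPaths.of_isClosed isClosedMap_toOrbit (isClosed_diagonalSlice c i) hV
    (fun A hA B hB h => ?_) fun y hy => ?_
  · obtain ⟨k, hk, rfl⟩ := toOrbit_eq_iff.1 h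
    obtain ⟨h01, h10⟩ := diagonal_of_mem_diagonalSlice hA.1 (hs A hA.2) hk hB.1
    refine ⟨(k • ·), continuous_const_smul k, fun z hz => ⟨⟨?_, ?_⟩, toOrbit_smul hk z⟩, rfl⟩
    · exact mem_diagonalSlice_of_diagonal hz.1 hk h01 h10
    · exact Set.mem_preimage.2 (by rw [toOrbit_smul hk]; exact hz.2)
  obtain ⟨A₀, rfl⟩ := toOrbit_surjective y
  obtain ⟨k₀, hk₀, hA⟩ := exists_mem_diagonalSlice c i A₀
  rw [← toOrbit_smul hk₀] at hy ⊢
  set A := k₀ • A₀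
  have hdiag {B : Tuple n} (hB : B ∈ diagonalSlice c i) (h : toOrbit B = toOrbit A) :
      ∃ k ∈ SU2, k.1 0 1 = 0 ∧ k.1 1 0 = 0 ∧ k • A = B := by
    obtain ⟨k, hk, rfl⟩ := toOrbit_eq_iff.1 h.symm
    obtain ⟨h01, h10⟩ := diagonal_of_mem_diagonalSlice hA (hs A hy) hk hB
    exact ⟨k, hk, h01, h10, rfl⟩
  -- The residual group is the diagonal torus. It fixes tuples of diagonal matrices; otherwise a
  -- nonzero off-diagonal entry, multiplied by units along the fiber, can be normalized to be
  -- positive.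
  by_cases hoff : ∀ j a b, a ≠ b → (A j).1 a b = 0
  · refine Or.inr ⟨A, hA, rfl, fun B hB h => ?_⟩
    obtain ⟨k, hk, h01, h10, rfl⟩ := hdiag hB h
    exact smul_eq_self_of_diagonal hk h01 h10 fun j a b hab => by rw [hoff j a b hab]; simp
  · push Not at hoff
    obtain ⟨j, a, b, hab, hne⟩ := hoff
    have hU : IsOpen {B : Tuple n | (B j).1 a b ≠ 0} :=
      isOpen_ne_fun ((continuous_entry a b).comp (continuous_tuple_apply j)) continuous_const
    obtain ⟨V', hV', hV'o, hyV'⟩ := eventually_nhds_iff.1 <|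
      isClosedMap_toOrbit.eventually_fiber_mem (isClosed_diagonalSlice c i) hU (y := toOrbit A)
        fun B hB h => by
          obtain ⟨k, hk, h01, h10, rfl⟩ := hdiag hB h
          have h0 (a) : k.1 a a ≠ 0 := left_ne_zero_of_mul_eq_one (normSq_entry_of_diagonal hk h01 h10 a)
          simp only [Set.mem_ofPred_eq, smul_val hk, conj_entry_of_diagonal h01 h10]
          exact mul_ne_zero (mul_ne_zero (h0 a) hne) ((map_ne_zero _).2 (h0 b))
    exact Or.inl ⟨V ∩ V', hV.inter hV'o, ⟨hy, hyV'⟩, liftsPaths_positiveSlice hab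
      (hV.inter hV'o) (fun B hB => hs B hB.1) fun B hB hBV => hV' _ hBV.2 B hB rfl⟩

/-- Paths of `SU(2)`-orbits of tuples lift to paths of tuples. -/
theorem liftsPaths_toOrbit : LiftsPaths (toOrbit (n := n)) Set.univ Set.univ := by
  refine LiftsPaths.of_isClosed isClosedMap_toOrbit isClosed_univ isOpen_univ
    (fun A _ B _ h => ?_) fun y _ => ?_
  · obtain ⟨k, hk, rfl⟩ := toOrbit_eq_iff.1 h
    exact ⟨(k • ·), continuous_const_smul k, fun z _ => ⟨⟨trivial, trivial⟩, toOrbit_smul hk z⟩, rfl⟩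
  obtain ⟨A, rfl⟩ := toOrbit_surjective y
  -- If all Hermitian combinations are scalar, so are the matrices, and SU(2) fixes the tuple.
  -- Otherwise a combination that stays non-scalar nearby is diagonalized.
  by_cases hsc : ∀ i c, IsScalar (herm c (A i).1)
  · refine Or.inr ⟨A, trivial, rfl, fun B _ h => ?_⟩
    obtain ⟨k, hk, rfl⟩ := toOrbit_eq_iff.1 h.symm
    funext i
    refine Subtype.ext ?_
    rw [smul_val hk, (isScalar_of_herm (hsc i)).conj hk]
  · push Not at hsc
    obtain ⟨i, c, hs⟩ := hsc
    have hU : IsOpen {B : Tuple n | ¬ IsScalar (herm c (B i).1)} := by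
      have : IsClosed {B : Tuple n | IsScalar (herm c (B i).1)} :=
        (isClosed_eq (continuous_herm c i 0 1) continuous_const).inter
        ((isClosed_eq (continuous_herm c i 1 0) continuous_const).inter
          (isClosed_eq (continuous_herm c i 0 0) (continuous_herm c i 1 1)))
      exact this.isOpen_compl
    obtain ⟨V, hV, hVo, hyV⟩ := eventually_nhds_iff.1 <|
      isClosedMap_toOrbit.eventually_fiber_mem isClosed_univ hU (y := toOrbit A)
        fun B _ h => by
          obtain ⟨k, hk, rfl⟩ := toOrbit_eq_iff.1 h
          intro hB
          have := hB.conj hk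
          rw [← herm_conj, ← smul_val hk] at this
          exact hs (this ▸ hB)
    exact Or.inl ⟨V, hVo, hyV, (liftsPaths_diagonalSlice (c := c) (i := i) hVo fun B hB =>
      hV _ hB B trivial rfl).mono (Set.subset_univ _) subset_rfl⟩

end SU2Quotient

/-! ### Tuples of minimal energy in their conjugacy class -/

section Minimal

open Matrix ComplexConjugate

variable {n : ℕ}

/-- The diagonal matrix with entries `s` and `s⁻¹`. -/
def diagSL (s : ℝ) (hs : 0 < s) : SL2C :=
  ⟨!![(s : ℂ), 0; 0, (s : ℂ)⁻¹], by simp [det_fin_two, hs.ne']⟩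

theorem diagSL_val (s : ℝ) (hs : 0 < s) : (diagSL s hs).1 = !![(s : ℂ), 0; 0, (s : ℂ)⁻¹] := rfl

theorem diagSL_inv_val (s : ℝ) (hs : 0 < s) :
    (diagSL s hs)⁻¹.1 = !![(s : ℂ)⁻¹, 0; 0, (s : ℂ)] := by
  rw [Matrix.SpecialLinearGroup.coe_inv, diagSL_val, adjugate_fin_two]
  simp

/-- The Cartan decomposition of `SL(2, ℂ)`. -/
theorem exists_cartan (g : SL2C) :
    ∃ k ∈ SU2, ∃ u ∈ SU2, ∃ (s : ℝ) (hs : 0 < s), g = k * diagSL s hs * u := by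
  -- Polar decomposition: the eigenvalues of gᴴg are positive with product 1, and `s` is the square
  -- root of the first.
  obtain ⟨u, hu, x, y, -, e⟩ := exists_SU2_diagonal (isHermitian_conjTranspose_mul_self g.1)
  have hdet (h : SL2C) : h.1.det = 1 := h.2
  have e1 : (g.1 * u.1ᴴ)ᴴ * (g.1 * u.1ᴴ) = diagonal ![(x : ℂ), y] := by
    rw [← e, conjTranspose_mul, conjTranspose_conjTranspose]
    simp only [Matrix.mul_assoc]
  have hxy : x * y = 1 := by
    have := congrArg Matrix.det e1
    rw [det_mul, det_conjTranspose, det_mul, det_conjTranspose, hdet, hdet, det_diagonal] at this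
    simp only [Fin.prod_univ_two] at this
    norm_num at this
    exact_mod_cast this.symm
  have hx : 0 ≤ x := by
    have := congrFun (congrFun e1 0) 0
    simp only [Matrix.mul_apply (M := (g.1 * u.1ᴴ)ᴴ), Fin.sum_univ_two, conjTranspose_apply (g.1 * u.1ᴴ),
      RCLike.star_def, ← Complex.normSq_eq_conj_mul_self, diagonal_apply_eq, cons_val_zero] at this
    have h2 := congrArg Complex.re this
    simp only [Complex.add_re, Complex.ofReal_re] at h2
    rw [← h2]
    exact add_nonneg (Complex.normSq_nonneg _) (Complex.normSq_nonneg _)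
  have hx0 : 0 < x := lt_of_le_of_ne hx (by rintro rfl; simp at hxy)
  have hs : 0 < √x := Real.sqrt_pos.2 hx0
  have hsx : ((√x : ℝ) : ℂ) * (√x : ℝ) = x := by
    rw [← Complex.ofReal_mul, Real.mul_self_sqrt hx]
  have hsC : ((√x : ℝ) : ℂ) ≠ 0 := by exact_mod_cast hs.ne'
  have hyx : (y : ℂ) = ((√x : ℝ) : ℂ)⁻¹ * ((√x : ℝ) : ℂ)⁻¹ := by
    rw [← mul_inv, hsx]
    exact eq_inv_of_mul_eq_one_right (by exact_mod_cast hxy)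
  refine ⟨g * u⁻¹ * (diagSL _ hs)⁻¹, ?_, u, hu, _, hs, by group⟩
  have hd : (diagSL _ hs)⁻¹.1ᴴ = (diagSL _ hs)⁻¹.1 := by
    rw [diagSL_inv_val]
    ext i j; fin_cases i <;> fin_cases j <;> simp
  rw [mem_SU2_iff, Matrix.SpecialLinearGroup.coe_mul, Matrix.SpecialLinearGroup.coe_mul,
    coe_inv_of_mem_SU2 hu, conjTranspose_mul, Matrix.mul_assoc, ← Matrix.mul_assoc (g.1 * u.1ᴴ)ᴴ,
    e1, hd, diagSL_inv_val]
  ext i j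
  fin_cases i <;> fin_cases j <;> simp [Matrix.mul_apply, ← hsx, hyx, hsC]

/-- The sum of the squares of the upper right entries. -/
def upper (A : Tuple n) : ℝ := ∑ i, Complex.normSq ((A i).1 0 1)

/-- The sum of the squares of the lower left entries. -/
def lower (A : Tuple n) : ℝ := ∑ i, Complex.normSq ((A i).1 1 0)

theorem continuous_tuple_entry (i : Fin n) (a b : Fin 2) :
    Continuous fun A : Tuple n => (A i).1 a b :=
  (continuous_entry a b).comp (continuous_tuple_apply i)

theorem continuous_upper : Continuous (upper (n := n)) :=
  continuous_finsetSum _ fun i _ => Complex.continuous_normSq.comp (continuous_tuple_entry i 0 1)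

theorem continuous_lower : Continuous (lower (n := n)) :=
  continuous_finsetSum _ fun i _ => Complex.continuous_normSq.comp (continuous_tuple_entry i 1 0)

theorem normSq_le_upper (A : Tuple n) (i : Fin n) : Complex.normSq ((A i).1 0 1) ≤ upper A :=
  Finset.single_le_sum (f := fun i => Complex.normSq ((A i).1 0 1))
    (fun _ _ => Complex.normSq_nonneg _) (Finset.mem_univ i)

theorem normSq_le_lower (A : Tuple n) (i : Fin n) : Complex.normSq ((A i).1 1 0) ≤ lower A :=
  Finset.single_le_sum (f := fun i => Complex.normSq ((A i).1 1 0))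
    (fun _ _ => Complex.normSq_nonneg _) (Finset.mem_univ i)

theorem upper_nonneg (A : Tuple n) : 0 ≤ upper A := Finset.sum_nonneg fun _ _ => Complex.normSq_nonneg _

theorem lower_nonneg (A : Tuple n) : 0 ≤ lower A := Finset.sum_nonneg fun _ _ => Complex.normSq_nonneg _

theorem diagSL_smul_val (s : ℝ) (hs : 0 < s) (A : Tuple n) (i : Fin n) :
    ((diagSL s hs • A) i).1 = !![(A i).1 0 0, ((s ^ 2 : ℝ) : ℂ) * (A i).1 0 1;
      ((s⁻¹ ^ 2 : ℝ) : ℂ) * (A i).1 1 0, (A i).1 1 1] := by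
  have hsC : (s : ℂ) ≠ 0 := by exact_mod_cast hs.ne'
  rw [conj_smul_apply, Matrix.SpecialLinearGroup.coe_mul, Matrix.SpecialLinearGroup.coe_mul,
    diagSL_inv_val, diagSL_val]
  ext a b
  fin_cases a <;> fin_cases b <;> simp [Matrix.mul_apply, Matrix.vecMul, dotProduct] <;> field_simp

theorem upper_diagSL_smul (s : ℝ) (hs : 0 < s) (A : Tuple n) :
    upper (diagSL s hs • A) = (s ^ 2) ^ 2 * upper A := by
  simp only [upper, Finset.mul_sum]
  refine Finset.sum_congr rfl fun i _ => ?_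
  rw [diagSL_smul_val]
  simp only [of_apply, cons_val', cons_val_zero, cons_val_one, Complex.normSq_mul,
    Complex.normSq_ofReal]
  ring

theorem lower_diagSL_smul (s : ℝ) (hs : 0 < s) (A : Tuple n) :
    lower (diagSL s hs • A) = (s⁻¹ ^ 2) ^ 2 * lower A := by
  simp only [lower, Finset.mul_sum]
  refine Finset.sum_congr rfl fun i _ => ?_
  rw [diagSL_smul_val]
  simp only [of_apply, cons_val', cons_val_zero, cons_val_one, Complex.normSq_mul,
    Complex.normSq_ofReal]
  ring

theorem energy_diagSL_smul (s : ℝ) (hs : 0 < s) (A : Tuple n) :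
    energy (diagSL s hs • A) - energy A =
      ((s ^ 2) ^ 2 - 1) * upper A + ((s⁻¹ ^ 2) ^ 2 - 1) * lower A := by
  have h (A : Tuple n) : energy A =
      ∑ i, (Complex.normSq ((A i).1 0 0) + Complex.normSq ((A i).1 1 1)) + upper A + lower A := by
    simp only [energy, upper, lower, normSqSum, ← Finset.sum_add_distrib]
    exact Finset.sum_congr rfl fun i _ => by ring
  rw [h, h A, upper_diagSL_smul, lower_diagSL_smul]
  simp only [diagSL_smul_val, of_apply, cons_val', cons_val_zero, cons_val_one]
  ring

/-- The tuple has minimal energy in its conjugacy class. -/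
def IsMinimal (A : Tuple n) : Prop := ∀ g : SL2C, energy A ≤ energy (g • A)

theorem isClosed_isMinimal : IsClosed {A : Tuple n | IsMinimal A} := by
  simp only [IsMinimal, Set.ofPred_forall]
  exact isClosed_iInter fun g => isClosed_le continuous_energy
    (continuous_energy.comp (continuous_const_smul g))

theorem IsMinimal.smul {A : Tuple n} (hA : IsMinimal A) {k : SL2C} (hk : k ∈ SU2) :
    IsMinimal (k • A) := fun g => by
  rw [energy_smul_of_mem_SU2 hk, ← mul_smul]
  exact hA _

theorem IsMinimal.signs_smul {A : Tuple n} (hA : IsMinimal A) (z : Signs n) :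
    IsMinimal (z • A) := fun g => by
  rw [energy_signs_smul, ← smul_comm, energy_signs_smul]
  exact hA g

/-- First variation of the energy along the diagonal one-parameter group: with t = s⁴ its derivative
at t = 1 is `upper A - lower A`. Letting t tend to 1 from either side gives the two inequalities. -/
theorem IsMinimal.upper_eq_lower {A : Tuple n} (hA : IsMinimal A) : upper A = lower A := by
  have h (t : ℝ) (ht : 0 < t) : 0 ≤ (t - 1) * (t * upper A - lower A) := by
    have h1 := hA (diagSL (√(√t)) (Real.sqrt_pos.2 (Real.sqrt_pos.2 ht)))
    rw [← sub_nonneg, energy_diagSL_smul, inv_pow, inv_pow, Real.sq_sqrt (Real.sqrt_nonneg t),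
      Real.sq_sqrt ht.le] at h1
    have : (t - 1) * (t * upper A - lower A) =
        t * ((t - 1) * upper A + (t⁻¹ - 1) * lower A) := by field_simp; ring
    rw [this]
    exact mul_nonneg ht.le h1
  have hc : Continuous fun t : ℝ => t * upper A := by fun_prop
  have hlim (s : Set ℝ) : Tendsto (fun t : ℝ => t * upper A) (𝓝[s] 1) (𝓝 (upper A)) :=
    (one_mul (upper A) ▸ hc.tendsto 1).mono_left nhdsWithin_le_nhds
  refine le_antisymm (le_of_tendsto (hlim (Set.Iio 1)) ?_) (ge_of_tendsto (hlim (Set.Ioi 1)) ?_)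
  · filter_upwards [Ioo_mem_nhdsLT (show (0 : ℝ) < 1 by norm_num)] with t ht
    have := h t ht.1
    by_contra! hlt
    nlinarith [ht.2, mul_pos (sub_pos.2 ht.2) (sub_pos.2 hlt)]
  · filter_upwards [self_mem_nhdsWithin] with t ht
    have ht' : 1 < t := ht
    have := h t (by linarith)
    by_contra! hlt
    nlinarith [mul_pos (sub_pos.2 ht') (sub_pos.2 hlt)]

/-- Applied to s² and s⁻², this bounds the squared displacement of an off-diagonal entry by a term
linear in s⁴ - 1 or s⁻⁴ - 1. -/
theorem sub_one_sq_le_abs {x : ℝ} (hx : 0 ≤ x) : (x - 1) ^ 2 ≤ |x ^ 2 - 1| := by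
  rw [show x ^ 2 - 1 = (x - 1) * (x + 1) by ring, abs_mul, ← sq_abs, sq]
  exact mul_le_mul_of_nonneg_left ((abs_sub x 1).trans (by
    rw [abs_of_nonneg hx, abs_one, abs_of_nonneg (by linarith : (0 : ℝ) ≤ x + 1)])) (abs_nonneg _)

/-- Limits of diagonal conjugates of minimal tuples do not move. -/
theorem eq_of_tendsto_diagSL_smul {ι : Type*} {l : Filter ι} [l.NeBot] {A : ι → Tuple n}
    {s : ι → ℝ} (hs : ∀ j, 0 < s j) {a b : Tuple n} (ha : IsMinimal a) (hb : IsMinimal b)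
    (hA : Tendsto A l (𝓝 a)) (hB : Tendsto (fun j => diagSL (s j) (hs j) • A j) l (𝓝 b)) :
    b = a := by
  -- The expression is the change of `upper - lower` under conjugation, and `upper - lower` tends to
  -- 0 along both families.
  have h1 : Tendsto (fun j => ((s j ^ 2) ^ 2 - 1) * upper (A j) +
      (1 - ((s j)⁻¹ ^ 2) ^ 2) * lower (A j)) l (𝓝 0) := by
    have hA' := ((continuous_upper.sub continuous_lower).tendsto a).comp hA
    have hB' := ((continuous_upper.sub continuous_lower).tendsto b).comp hB
    have := hB'.sub hA'
    simp only [Pi.sub_apply, ha.upper_eq_lower, hb.upper_eq_lower, sub_self] at this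
    refine this.congr fun j => ?_
    simp only [Function.comp, Pi.sub_apply, upper_diagSL_smul, lower_diagSL_smul]
    ring
  have h2 := h1.abs
  rw [abs_zero] at h2
  -- The two summands have the same sign, so each tends to 0 separately, with no bound on `s`.
  have hsum (j) : |((s j ^ 2) ^ 2 - 1) * upper (A j) + (1 - ((s j)⁻¹ ^ 2) ^ 2) * lower (A j)| =
      |(s j ^ 2) ^ 2 - 1| * upper (A j) + |((s j)⁻¹ ^ 2) ^ 2 - 1| * lower (A j) := by
    have hu := upper_nonneg (A j)
    have hl := lower_nonneg (A j)
    have hp : 0 < (s j ^ 2) ^ 2 := by have := hs j; positivity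
    rw [inv_pow, inv_pow]
    generalize (s j ^ 2) ^ 2 = p at *
    rcases le_total 1 p with h | h
    · have h' : p⁻¹ ≤ 1 := inv_le_one_of_one_le₀ h
      rw [abs_of_nonneg (a := p - 1) (by linarith), abs_of_nonpos (a := p⁻¹ - 1) (by linarith),
        abs_of_nonneg (add_nonneg (mul_nonneg (by linarith) hu) (mul_nonneg (by linarith) hl))]
      ring
    · have h' : 1 ≤ p⁻¹ := (one_le_inv₀ hp).2 h
      rw [abs_of_nonpos (a := p - 1) (by linarith), abs_of_nonneg (a := p⁻¹ - 1) (by linarith),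
        abs_of_nonpos (add_nonpos (mul_nonpos_of_nonpos_of_nonneg (by linarith) hu)
          (mul_nonpos_of_nonpos_of_nonneg (by linarith) hl))]
      ring
  have hentry (i : Fin n) (x y : Fin 2) (hle : ∀ j, Complex.normSq
      (((diagSL (s j) (hs j) • A j) i).1 x y - (A j i).1 x y) ≤
      |(s j ^ 2) ^ 2 - 1| * upper (A j) + |((s j)⁻¹ ^ 2) ^ 2 - 1| * lower (A j)) :
      (b i).1 x y = (a i).1 x y := by
    have hlim : Tendsto (fun j => Complex.normSq
        (((diagSL (s j) (hs j) • A j) i).1 x y - (A j i).1 x y)) l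
        (𝓝 (Complex.normSq ((b i).1 x y - (a i).1 x y))) :=
      (Complex.continuous_normSq.tendsto _).comp
        ((((continuous_tuple_entry i x y).tendsto b).comp hB).sub
          (((continuous_tuple_entry i x y).tendsto a).comp hA))
    have hzero := squeeze_zero (fun j => Complex.normSq_nonneg _)
      (fun j => (hle j).trans (hsum j).ge) h2
    exact sub_eq_zero.1 (Complex.normSq_eq_zero.1 (tendsto_nhds_unique hlim hzero))
  have hx (x : ℝ) (z : ℂ) (hx0 : 0 ≤ x) (m : ℝ) (hm : Complex.normSq z ≤ m) :
      Complex.normSq ((x : ℂ) * z - z) ≤ |x ^ 2 - 1| * m := by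
    rw [← sub_one_mul, Complex.normSq_mul, ← Complex.ofReal_one, ← Complex.ofReal_sub,
      Complex.normSq_ofReal, ← sq]
    exact mul_le_mul (sub_one_sq_le_abs hx0) hm (Complex.normSq_nonneg _) (abs_nonneg _)
  have hU (j) : 0 ≤ |(s j ^ 2) ^ 2 - 1| * upper (A j) :=
    mul_nonneg (abs_nonneg _) (upper_nonneg _)
  have hL (j) : 0 ≤ |((s j)⁻¹ ^ 2) ^ 2 - 1| * lower (A j) :=
    mul_nonneg (abs_nonneg _) (lower_nonneg _)
  funext i
  refine Subtype.ext (Matrix.ext fun x y => hentry i x y fun j => ?_)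
  rw [diagSL_smul_val]
  fin_cases x <;> fin_cases y
  · simpa using add_nonneg (hU j) (hL j)
  · exact (hx _ _ (sq_nonneg _) _ (normSq_le_upper (A j) i)).trans (le_add_of_nonneg_right (hL j))
  · exact (hx _ _ (sq_nonneg _) _ (normSq_le_lower (A j) i)).trans (le_add_of_nonneg_left (hU j))
  · simpa using add_nonneg (hU j) (hL j)

/-- Minimal tuples that are limits of conjugate tuples are conjugate under `SU(2)`. -/
theorem IsMinimal.exists_smul_eq_of_tendsto {ι : Type*} {l : Ultrafilter ι} {A : ι → Tuple n}
    {g : ι → SL2C} {a b : Tuple n} (ha : IsMinimal a) (hb : IsMinimal b)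
    (hA : Tendsto A l (𝓝 a)) (hB : Tendsto (fun j => g j • A j) l (𝓝 b)) :
    ∃ k ∈ SU2, k • a = b := by
  -- The unitary factors converge along the ultrafilter by compactness; the diagonal factors may
  -- diverge.
  choose k hk u hu s hs e using fun j => exists_cartan (g j)
  have hlim (k : ι → SL2C) (hk : ∀ j, k j ∈ SU2) : ∃ k₀ ∈ SU2, Tendsto k l (𝓝 k₀) := by
    have hc : IsCompact (SU2 : Set SL2C) := isCompact_iff_compactSpace.2 (inferInstanceAs (CompactSpace SU2))
    exact hc.ultrafilter_le_nhds (l.map k) (le_principal_iff.2 (mem_map.2 (Filter.univ_mem' hk)))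
  obtain ⟨k₀, hk₀, hkl⟩ := hlim k hk
  obtain ⟨u₀, hu₀, hul⟩ := hlim u hu
  have hB' : Tendsto (fun j => diagSL (s j) (hs j) • u j • A j) l (𝓝 (k₀⁻¹ • b)) := by
    refine (hkl.inv.smul hB).congr fun j => ?_
    rw [e j, ← mul_smul, ← mul_smul]
    congr 1
    group
  have := eq_of_tendsto_diagSL_smul hs (ha.smul hu₀) (hb.smul (inv_mem hk₀)) (hul.smul hA) hB'
  refine ⟨k₀ * u₀, mul_mem hk₀ hu₀, ?_⟩
  rw [mul_smul, ← this, smul_inv_smul]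

/-- Minimal tuples that are limits of tuples conjugate up to signs are conjugate under `SU(2)` up to
signs. -/
theorem IsMinimal.exists_smul_smul_eq_of_mem_closure {a b : Tuple n} (ha : IsMinimal a)
    (hb : IsMinimal b)
    (h : (a, b) ∈ closure {x : Tuple n × Tuple n | ∃ (z : Signs n) (g : SL2C), x.2 = z • g • x.1}) :
    ∃ z : Signs n, ∃ k ∈ SU2, z • k • a = b := by
  obtain ⟨l, hl, hab⟩ := mem_closure_iff_ultrafilter.1 h
  have h1 : Tendsto Prod.fst (l : Filter (Tuple n × Tuple n)) (𝓝 a) :=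
    (continuous_fst.tendsto (a, b)).mono_left hab
  have h2 : Tendsto Prod.snd (l : Filter (Tuple n × Tuple n)) (𝓝 b) :=
    (continuous_snd.tendsto (a, b)).mono_left hab
  have hl' : ∀ᶠ x in (l : Filter (Tuple n × Tuple n)),
      ∃ (z : Signs n), ∃ g : SL2C, x.2 = z • g • x.1 := hl
  -- There are finitely many signs, so the ultrafilter selects one.
  obtain ⟨z, hz⟩ := Ultrafilter.eventually_exists_iff.1 hl'
  have : ∃ g : Tuple n × Tuple n → SL2C, ∀ᶠ x in (l : Filter (Tuple n × Tuple n)),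
      z⁻¹ • x.2 = g x • x.1 := by
    choose! g hg using fun (x : Tuple n × Tuple n) (h : ∃ g : SL2C, x.2 = z • g • x.1) => h
    exact ⟨g, hz.mono fun x hx => by rw [inv_smul_eq_iff]; exact hg x hx⟩
  obtain ⟨g, hg⟩ := this
  obtain ⟨k, hk, e⟩ := ha.exists_smul_eq_of_tendsto (hb.signs_smul z⁻¹) h1
    (((continuous_const_smul z⁻¹).tendsto b |>.comp h2).congr' hg)
  exact ⟨z, k, hk, by rw [e, smul_inv_smul]⟩

end Minimal

/-! ### Lifting representations to tuples of matrices -/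

section CharacterVarieties

variable {n : ℕ} {Γ : Type*} [Group Γ] {φ : FreeGroup (Fin n) →* Γ}

/-- The tuple of elements of `PSL(2, ℂ)` represented by a tuple of matrices. -/
def toPSL (A : Tuple n) : Fin n → PSL2C := fun i => (QuotientGroup.mk (A i) : PSL2C)

theorem isOpenQuotientMap_toPSL : IsOpenQuotientMap (toPSL (n := n)) :=
  IsOpenQuotientMap.piMap (f := fun (_ : Fin n) (g : SL2C) => (QuotientGroup.mk g : PSL2C))
    fun _ => QuotientGroup.isOpenQuotientMap_mk

theorem toPSL_eq_iff {A B : Tuple n} : toPSL A = toPSL B ↔ ∃ z : Signs n, z • A = B := by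
  constructor
  · intro h
    have h' (i : Fin n) : (A i)⁻¹ * B i ∈ Subgroup.center SL2C :=
      QuotientGroup.eq.1 (congrFun h i)
    refine ⟨fun i => ⟨_, h' i⟩, funext fun i => ?_⟩
    rw [signs_smul_apply, ← center_comm, mul_inv_cancel_left]
  · rintro ⟨z, rfl⟩
    funext i
    refine QuotientGroup.eq.2 ?_
    rw [signs_smul_apply, ← center_comm, inv_mul_cancel_left]
    exact (z i).2

variable (φ) in
/-- The values of a representation at the generators. -/
def evalGenerators (ρ : RepresentationVariety Γ) : Fin n → PSL2C := fun i => ρ (φ (FreeGroup.of i))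

theorem lift_evalGenerators (ρ : RepresentationVariety Γ) (w : FreeGroup (Fin n)) :
    FreeGroup.lift (evalGenerators φ ρ) w = ρ (φ w) :=
  DFunLike.congr_fun (FreeGroup.ext_hom (f := FreeGroup.lift (evalGenerators φ ρ))
    (g := ρ.comp φ) fun i => by simp [evalGenerators]) w

theorem continuous_lift_apply {G : Type*} [Group G] [TopologicalSpace G] [IsTopologicalGroup G]
    (w : FreeGroup (Fin n)) : Continuous fun x : Fin n → G => FreeGroup.lift x w := by
  induction w using FreeGroup.induction_on with
  | C1 => simpa using continuous_const
  | of i => simpa using continuous_apply i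
  | inv_of i h => simpa [Function.comp_def] using continuous_inv.comp h
  | mul v w hv hw => simpa [Pi.mul_def] using hv.mul hw

/-- Each value of a representation is a word in its values at the generators, hence a continuous
function of them. -/
theorem isInducing_evalGenerators (hφ : Function.Surjective φ) :
    IsInducing (evalGenerators φ) := by
  have hcoe : Continuous fun (ρ : RepresentationVariety Γ) (γ : Γ) => ρ γ := continuous_induced_dom
  refine ⟨le_antisymm ?_ ?_⟩
  · rw [← continuous_iff_le_induced]
    exact continuous_pi fun i => (continuous_apply (φ (FreeGroup.of i))).comp hcoe
  · obtain ⟨s, hs⟩ := hφ.hasRightInverse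
    have hF : Continuous fun (x : Fin n → PSL2C) (γ : Γ) => FreeGroup.lift x (s γ) :=
      continuous_pi fun γ => continuous_lift_apply _
    have hcomp : (fun (ρ : RepresentationVariety Γ) (γ : Γ) => ρ γ) =
        (fun (x : Fin n → PSL2C) (γ : Γ) => FreeGroup.lift x (s γ)) ∘ evalGenerators φ := by
      funext ρ γ
      simp only [Function.comp_apply, lift_evalGenerators, hs γ]
    change _ ≤ TopologicalSpace.induced (fun (ρ : RepresentationVariety Γ) (γ : Γ) => ρ γ) _
    rw [hcomp, ← induced_compose]
    exact induced_mono hF.le_induced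

variable (φ) in
/-- The tuple of matrices represents the values of `ρ` at the generators. -/
def IsLiftOf (A : Tuple n) (ρ : RepresentationVariety Γ) : Prop := toPSL A = evalGenerators φ ρ

theorem exists_isLiftOf (ρ : RepresentationVariety Γ) : ∃ A, IsLiftOf φ A ρ :=
  isOpenQuotientMap_toPSL.surjective _

theorem IsLiftOf.smul {A : Tuple n} {ρ : RepresentationVariety Γ} (h : IsLiftOf φ A ρ)
    (z : Signs n) (g : SL2C) : IsLiftOf φ (z • g • A) (conjRep (QuotientGroup.mk g) ρ) := by
  rw [IsLiftOf, ← toPSL_eq_iff.2 ⟨z, rfl⟩]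
  funext i
  have : (QuotientGroup.mk (A i) : PSL2C) = ρ (φ (FreeGroup.of i)) := congrFun h i
  simp only [toPSL, conj_smul_apply, evalGenerators, conjRep, QuotientGroup.mk_mul,
    QuotientGroup.mk_inv, this]
  rfl

theorem IsLiftOf.signs_smul {A : Tuple n} {ρ : RepresentationVariety Γ} (h : IsLiftOf φ A ρ)
    (z : Signs n) : IsLiftOf φ (z • A) ρ := by
  rw [IsLiftOf, ← toPSL_eq_iff.2 ⟨z, rfl⟩]
  exact h

/-- A tuple comes from a representation exactly when every word in the kernel of `φ` evaluates to a
central element, and the center is finite, hence closed. -/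
theorem isClosed_setOf_isLiftOf (hφ : Function.Surjective φ) :
    IsClosed {A : Tuple n | ∃ ρ, IsLiftOf φ A ρ} := by
  have h : {A : Tuple n | ∃ ρ, IsLiftOf φ A ρ} =
      ⋂ w : φ.ker, {A : Tuple n | FreeGroup.lift (A : Fin n → SL2C) w ∈ Subgroup.center SL2C} := by
    ext A
    have hmk (a : Fin n → SL2C) (w : FreeGroup (Fin n)) :
        FreeGroup.lift (fun i => (QuotientGroup.mk (a i) : PSL2C)) w =
          (QuotientGroup.mk (FreeGroup.lift a w) : PSL2C) :=
      DFunLike.congr_fun (FreeGroup.ext_hom (f := FreeGroup.lift fun i =>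
        (QuotientGroup.mk (a i) : PSL2C))
        (g := (QuotientGroup.mk' (Subgroup.center SL2C)).comp (FreeGroup.lift a))
        fun i => by simp) w
    have hc (w : FreeGroup (Fin n)) : FreeGroup.lift (toPSL A) w = 1 ↔
        FreeGroup.lift (A : Fin n → SL2C) w ∈ Subgroup.center SL2C :=
      (iff_of_eq (congrArg (· = 1) (hmk A w))).trans (QuotientGroup.eq_one_iff _)
    simp only [Set.mem_ofPred_eq, Set.mem_iInter, ← hc]
    constructor
    · rintro ⟨ρ, h⟩ ⟨w, hw⟩
      rw [h, lift_evalGenerators, MonoidHom.mem_ker.1 hw, map_one]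
    · intro h
      refine ⟨φ.liftOfSurjective hφ ⟨FreeGroup.lift (toPSL A), fun w hw => h ⟨w, hw⟩⟩, ?_⟩
      funext i
      exact (FreeGroup.lift_apply_of).symm.trans
        (φ.liftOfRightInverse_comp_apply _ (Function.rightInverse_surjInv hφ)
          ⟨FreeGroup.lift (toPSL A), fun w hw => h ⟨w, hw⟩⟩ (FreeGroup.of i)).symm
  rw [h]
  refine isClosed_iInter fun w => IsClosed.preimage (f := fun A : Tuple n =>
    FreeGroup.lift (A : Fin n → SL2C) (w : FreeGroup (Fin n))) (continuous_lift_apply _) ?_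
  have : Finite (Subgroup.center SL2C : Set SL2C) :=
    inferInstanceAs (Finite (Subgroup.center SL2C))
  exact (Set.toFinite (Subgroup.center SL2C : Set SL2C)).isClosed

theorem isOpen_setOf_exists_isLiftOf (hφ : Function.Surjective φ) {U : Set (Tuple n)}
    (hU : IsOpen U) : IsOpen {ρ : RepresentationVariety Γ | ∃ A ∈ U, IsLiftOf φ A ρ} :=
  (isOpenQuotientMap_toPSL.isOpenMap U hU).preimage (isInducing_evalGenerators hφ).continuous

/-! ### Orbit closures and minimal lifts -/

/-- The orbit of a tuple under conjugation and change of signs. -/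
def signedOrbit (A : Tuple n) : Set (Tuple n) := {B | ∃ (z : Signs n) (g : SL2C), B = z • g • A}

theorem self_mem_signedOrbit (A : Tuple n) : A ∈ signedOrbit A := ⟨1, 1, by simp⟩

theorem smul_mem_signedOrbit {A B : Tuple n} (hB : B ∈ signedOrbit A) (z : Signs n) (g : SL2C) :
    z • g • B ∈ signedOrbit A := by
  obtain ⟨z', g', rfl⟩ := hB
  exact ⟨z * z', g * g', by rw [mul_smul, mul_smul, smul_comm z' g]⟩

theorem smul_mem_closure_signedOrbit {A B : Tuple n} (hB : B ∈ closure (signedOrbit A))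
    (z : Signs n) (g : SL2C) : z • g • B ∈ closure (signedOrbit A) :=
  map_mem_closure (f := fun B => z • g • B)
    ((continuous_const_smul z).comp (continuous_const_smul g)) hB fun _ hC =>
    smul_mem_signedOrbit hC z g

theorem closure_signedOrbit_subset {A B : Tuple n} (hB : B ∈ closure (signedOrbit A)) :
    closure (signedOrbit B) ⊆ closure (signedOrbit A) :=
  closure_minimal (by rintro C ⟨z, g, rfl⟩; exact smul_mem_closure_signedOrbit hB z g)
    isClosed_closure

/-- Since `toPSL` is continuous and open with fibers the orbits of the signs, orbit closures can be
computed on tuples of matrices. -/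
theorem mem_closure_conjOrbit_iff (hφ : Function.Surjective φ) {A B : Tuple n}
    {ρ ρ' : RepresentationVariety Γ} (hA : IsLiftOf φ A ρ) (hB : IsLiftOf φ B ρ') :
    ρ' ∈ closure (conjOrbit ρ) ↔ B ∈ closure (signedOrbit A) := by
  constructor
  · intro h
    rw [mem_closure_iff]
    intro U hU hBU
    obtain ⟨_, ⟨C, hCU, hC⟩, ⟨a, rfl⟩⟩ := mem_closure_iff.1 h _
      (isOpen_setOf_exists_isLiftOf hφ hU) ⟨B, hBU, hB⟩
    obtain ⟨g, rfl⟩ := QuotientGroup.mk_surjective a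
    obtain ⟨z, rfl⟩ := toPSL_eq_iff.1 ((hA.smul 1 g).trans hC.symm)
    exact ⟨_, hCU, z, g, by rw [one_smul]⟩
  · intro h
    rw [(isInducing_evalGenerators hφ).closure_eq_preimage_closure_image, Set.mem_preimage,
      ← show toPSL B = _ from hB]
    refine map_mem_closure isOpenQuotientMap_toPSL.continuous h ?_
    rintro _ ⟨z, g, rfl⟩
    exact ⟨_, ⟨QuotientGroup.mk g, rfl⟩, (hA.smul z g).symm⟩

variable (φ) in
/-- The minimal tuples that lift a representation. -/
def minimalLifts : Set (Tuple n) := {A | IsMinimal A ∧ ∃ ρ, IsLiftOf φ A ρ}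

theorem isClosed_minimalLifts (hφ : Function.Surjective φ) : IsClosed (minimalLifts φ) :=
  isClosed_isMinimal.inter (isClosed_setOf_isLiftOf hφ)

/-- Two tuples are in the same orbit of `SU(2)`, up to signs. -/
def UnitaryEquiv (A B : Tuple n) : Prop := ∃ z : Signs n, ∃ k ∈ SU2, z • k • A = B

theorem UnitaryEquiv.symm {A B : Tuple n} (h : UnitaryEquiv A B) : UnitaryEquiv B A := by
  obtain ⟨z, k, hk, rfl⟩ := h
  exact ⟨z⁻¹, k⁻¹, inv_mem hk, by rw [← smul_comm z k⁻¹, inv_smul_smul, inv_smul_smul]⟩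

theorem UnitaryEquiv.trans {A B C : Tuple n} (h : UnitaryEquiv A B) (h' : UnitaryEquiv B C) :
    UnitaryEquiv A C := by
  obtain ⟨z, k, hk, rfl⟩ := h
  obtain ⟨z', k', hk', rfl⟩ := h'
  exact ⟨z' * z, k' * k, mul_mem hk' hk, by rw [mul_smul, mul_smul, smul_comm z k']⟩

theorem UnitaryEquiv.mem_signedOrbit {A B : Tuple n} (h : UnitaryEquiv A B) : B ∈ signedOrbit A := by
  obtain ⟨z, k, -, rfl⟩ := h
  exact ⟨z, k, rfl⟩

theorem UnitaryEquiv.energy_eq {A B : Tuple n} (h : UnitaryEquiv A B) : energy A = energy B := by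
  obtain ⟨z, k, hk, rfl⟩ := h
  rw [energy_signs_smul, energy_smul_of_mem_SU2 hk]

/-- Energy sublevels are compact, so the energy attains its minimum on the orbit closure. The
closure is invariant, so the minimizer is minimal in its own orbit, though it may lie outside the
original one. -/
theorem exists_mem_minimalLifts (hφ : Function.Surjective φ) {A : Tuple n}
    {ρ : RepresentationVariety Γ} (hA : IsLiftOf φ A ρ) :
    ∃ B ∈ minimalLifts φ, B ∈ closure (signedOrbit A) ∧ energy B ≤ energy A := by
  have hK : IsCompact (closure (signedOrbit A) ∩ {B | energy B ≤ energy A}) :=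
    (isCompact_energy_le _).inter_left isClosed_closure
  obtain ⟨B, ⟨hB, hBA⟩, hmin⟩ := hK.exists_isMinOn
    ⟨A, subset_closure (self_mem_signedOrbit A), le_refl (energy A)⟩ continuous_energy.continuousOn
  refine ⟨B, ⟨fun g => ?_, ?_⟩, hB, hBA⟩
  · rcases le_total (energy (g • B)) (energy A) with h | h
    · refine hmin ⟨?_, h⟩
      simpa using smul_mem_closure_signedOrbit hB 1 g
    · exact le_trans hBA h
  · refine closure_minimal ?_ (isClosed_setOf_isLiftOf hφ) hB
    rintro _ ⟨z, g, rfl⟩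
    exact ⟨_, hA.smul z g⟩

/-- Uniqueness in Kempf–Ness: the pair is a limit of pairs of points of one signed orbit. -/
theorem unitaryEquiv_of_mem_closure {A B C : Tuple n} (hA : IsMinimal A) (hB : IsMinimal B)
    (hAC : A ∈ closure (signedOrbit C)) (hBC : B ∈ closure (signedOrbit C)) :
    UnitaryEquiv A B := by
  refine hA.exists_smul_smul_eq_of_mem_closure hB ?_
  have : (A, B) ∈ closure (signedOrbit C ×ˢ signedOrbit C) := by
    rw [closure_prod_eq]
    exact ⟨hAC, hBC⟩
  refine closure_mono ?_ this
  rintro ⟨_, _⟩ ⟨⟨z, g, rfl⟩, ⟨z', g', rfl⟩⟩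
  refine ⟨z' * z⁻¹, g' * g⁻¹, ?_⟩
  change z' • g' • C = _
  rw [mul_smul, mul_smul, ← smul_comm z (g⁻¹), inv_smul_smul, ← smul_comm z g', inv_smul_smul]

/-- Equality in the quotient means equivalence for the generated relation, hence the induction. A
generating pair is compared through a minimal tuple over a common limit of the two orbits, and a
transitive chain through one over the middle representation. -/
theorem unitaryEquiv_of_toCharacterVariety_eq (hφ : Function.Surjective φ)
    {ρ ρ' : RepresentationVariety Γ} (h : toCharacterVariety ρ = toCharacterVariety ρ')
    {A' B' A B : Tuple n} (hA' : IsLiftOf φ A' ρ) (hB' : IsLiftOf φ B' ρ') (hA : IsMinimal A)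
    (hB : IsMinimal B) (hAA' : A ∈ closure (signedOrbit A'))
    (hBB' : B ∈ closure (signedOrbit B')) : UnitaryEquiv A B := by
  have key := Quot.eqvGen_exact h
  clear h
  induction key generalizing A' B' A B with
  | rel ρ ρ' h =>
    obtain ⟨τ, h1, h2⟩ := h
    obtain ⟨C', hC'⟩ := exists_isLiftOf (φ := φ) τ
    obtain ⟨C, hC, hCC', -⟩ := exists_mem_minimalLifts hφ hC'
    rw [mem_closure_conjOrbit_iff hφ hA' hC'] at h1
    rw [mem_closure_conjOrbit_iff hφ hB' hC'] at h2
    exact (unitaryEquiv_of_mem_closure hA hC.1 hAA' (closure_signedOrbit_subset h1 hCC')).trans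
      (unitaryEquiv_of_mem_closure hC.1 hB (closure_signedOrbit_subset h2 hCC') hBB')
  | refl ρ =>
    obtain ⟨z, rfl⟩ := toPSL_eq_iff.1 (hA'.trans hB'.symm)
    refine unitaryEquiv_of_mem_closure hA hB hAA' (closure_signedOrbit_subset (subset_closure ?_) hBB')
    exact ⟨z, 1, by rw [one_smul]⟩
  | symm ρ ρ' _ ih => exact (ih hB' hA' hB hA hBB' hAA').symm
  | trans ρ ρ' τ _ _ ih1 ih2 =>
    obtain ⟨C', hC'⟩ := exists_isLiftOf (φ := φ) ρ'
    obtain ⟨C, hC, hCC', -⟩ := exists_mem_minimalLifts hφ hC'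
    exact (ih1 hA' hC' hA hC.1 hAA' hCC').trans (ih2 hC' hB' hC.1 hB hCC' hBB')

theorem toCharacterVariety_eq_of_mem_closure (hφ : Function.Surjective φ)
    {ρ ρ' : RepresentationVariety Γ} {A B : Tuple n} (hA : IsLiftOf φ A ρ) (hB : IsLiftOf φ B ρ')
    (h : B ∈ closure (signedOrbit A)) : toCharacterVariety ρ = toCharacterVariety ρ' :=
  Quot.sound ⟨ρ', (mem_closure_conjOrbit_iff hφ hA hB).2 h, subset_closure ⟨1, conjRep_one ρ'⟩⟩

theorem isQuotientMap_toCharacterVariety : IsQuotientMap (toCharacterVariety (Γ := Γ)) :=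
  isQuotientMap_quot_mk

/-- The classes of the representations that have minimal lifts in a closed set form a closed set. -/
theorem isClosed_setOf_toCharacterVariety (hφ : Function.Surjective φ) {C : Set (Tuple n)}
    (hC : IsClosed C) : IsClosed {η : CharacterVariety Γ | ∃ A ∈ C, IsMinimal A ∧
      ∃ ρ, IsLiftOf φ A ρ ∧ toCharacterVariety ρ = η} := by
  rw [← isQuotientMap_toCharacterVariety.isClosed_preimage]
  set Z := toCharacterVariety (Γ := Γ) ⁻¹' {η : CharacterVariety Γ | ∃ A ∈ C,
    IsMinimal A ∧ ∃ ρ, IsLiftOf φ A ρ ∧ toCharacterVariety ρ = η}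
  refine isClosed_of_closure_subset fun ρ₀ hρ₀ => ?_
  obtain ⟨X, hX⟩ := exists_isLiftOf (φ := φ) ρ₀
  have hXcl : X ∈ closure {x : Tuple n | ∃ ρ ∈ Z, IsLiftOf φ x ρ} := by
    rw [mem_closure_iff]
    intro U hU hXU
    obtain ⟨ρ, ⟨x, hxU, hx⟩, hρZ⟩ := mem_closure_iff.1 hρ₀ _
      (isOpen_setOf_exists_isLiftOf hφ hU) ⟨X, hXU, hX⟩
    exact ⟨x, hxU, ρ, hρZ, hx⟩
  obtain ⟨l, hl, hlX⟩ := mem_closure_iff_ultrafilter.1 hXcl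
  -- The energy bound passes from the minimizer near the orbit of `x` to the given tuple in `C`,
  -- since both are unitarily equivalent.
  have hex : ∀ x ∈ {x : Tuple n | ∃ ρ ∈ Z, IsLiftOf φ x ρ}, ∃ A ∈ C ∩ minimalLifts φ,
      A ∈ closure (signedOrbit x) ∧ energy A ≤ energy x := by
    rintro x ⟨ρ, ⟨A, hAC, hA, ρ', hAρ', e⟩, hx⟩
    obtain ⟨B, hB, hBx, hBe⟩ := exists_mem_minimalLifts hφ hx
    have hAB : UnitaryEquiv B A := unitaryEquiv_of_toCharacterVariety_eq hφ
      (show toCharacterVariety ρ = toCharacterVariety ρ' from e.symm) hx hAρ' hB.1 hA hBx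
      (subset_closure (self_mem_signedOrbit A))
    exact ⟨A, ⟨hAC, hA, ρ', hAρ'⟩, closure_signedOrbit_subset hBx
      (subset_closure hAB.mem_signedOrbit), hAB.energy_eq.ge.trans hBe⟩
  have : Nonempty (Tuple n) := ⟨X⟩
  choose! c hc hcx hce using hex
  -- As `x` tends to `X`, the chosen minimal tuples `c x` have bounded energy, so they accumulate in
  -- `C`.
  have hK : IsCompact ({A : Tuple n | energy A ≤ energy X + 1} ∩ (C ∩ minimalLifts φ)) :=
    (isCompact_energy_le _).inter_right (hC.inter (isClosed_minimalLifts hφ))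
  have hev : ∀ᶠ x in (l : Filter (Tuple n)), energy x < energy X + 1 :=
    hlX (continuous_energy.continuousAt.eventually_lt_const (lt_add_one _))
  obtain ⟨A, ⟨-, hAC, hAmin, ρ', hAρ'⟩, hcA⟩ := hK.ultrafilter_le_nhds (l.map c) <| by
    refine le_principal_iff.2 (mem_map.2 ?_)
    filter_upwards [hev, hl] with x hx hxl
    exact ⟨(hce x hxl).trans hx.le, hc x hxl⟩
  obtain ⟨B, ⟨hBmin, τ, hBτ⟩, hBX, -⟩ := exists_mem_minimalLifts hφ hX
  have hAB : UnitaryEquiv A B := by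
    -- A fixed sign change and conjugation brings `X` near `B`, hence also every `x` close to `X`.
    -- Some other point of the orbit of `x` is near `c x`, and so near `A`.
    refine hAmin.exists_smul_smul_eq_of_mem_closure hBmin (mem_closure_iff_nhds.2 fun N hN => ?_)
    obtain ⟨U, hU, W, hW, hUW⟩ := mem_nhds_prod_iff.1 hN
    obtain ⟨_, hzW, z, g, rfl⟩ := mem_closure_iff_nhds.1 hBX _ (interior_mem_nhds.2 hW)
    have h1 : ∀ᶠ x in (l : Filter (Tuple n)), z • g • x ∈ interior W :=
      hlX ((((continuous_const_smul z).comp (continuous_const_smul g)).tendsto X).eventually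
        (isOpen_interior.mem_nhds hzW))
    have h2 : ∀ᶠ x in (l : Filter (Tuple n)), c x ∈ interior U :=
      hcA (interior_mem_nhds.2 hU)
    have h3 : ∀ᶠ x in (l : Filter (Tuple n)), x ∈ {x : Tuple n | ∃ ρ ∈ Z, IsLiftOf φ x ρ} := hl
    obtain ⟨x, hx1, hx2, hx3⟩ := (h1.and (h2.and h3)).exists
    obtain ⟨_, hwU, w, h, rfl⟩ := mem_closure_iff.1 (hcx x hx3) _ isOpen_interior hx2
    refine ⟨(w • h • x, z • g • x), hUW ⟨interior_subset hwU, interior_subset hx1⟩,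
      z * w⁻¹, g * h⁻¹, ?_⟩
    change z • g • x = _
    rw [mul_smul, mul_smul, ← smul_comm w (h⁻¹), inv_smul_smul, ← smul_comm w g, inv_smul_smul]
  refine ⟨A, hAC, hAmin, ρ', hAρ', ?_⟩
  exact (toCharacterVariety_eq_of_mem_closure hφ hAρ' hBτ (subset_closure hAB.mem_signedOrbit)).trans
    (toCharacterVariety_eq_of_mem_closure hφ hX hBτ hBX).symm

end CharacterVarieties

/-! ### Lifting paths of the character variety -/

section CharacterVarietyPaths

variable {n : ℕ} {Γ : Type*} [Group Γ] {φ : FreeGroup (Fin n) →* Γ}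

/-- The action of central elements on orbits of tuples. -/
instance : MulAction (Signs n) (OrbitSpace n) where
  smul z := Quotient.map (z • ·) fun A B h => by
    obtain ⟨k, rfl⟩ := h
    exact ⟨k, (smul_comm z (k : SL2C) B).symm⟩
  one_smul w := by
    obtain ⟨A, rfl⟩ := toOrbit_surjective w
    exact congrArg toOrbit (one_smul (Signs n) A)
  mul_smul z z' w := by
    obtain ⟨A, rfl⟩ := toOrbit_surjective w
    exact congrArg toOrbit (mul_smul z z' A)

theorem signs_smul_toOrbit (z : Signs n) (A : Tuple n) : z • toOrbit A = toOrbit (z • A) := rfl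

instance : ContinuousConstSMul (Signs n) (OrbitSpace n) where
  continuous_const_smul z := isOpenQuotientMap_toOrbit.continuous_comp_iff.1
    (continuous_toOrbit.comp (continuous_const_smul z) : _)

theorem toCharacterVariety_eq_iff (hφ : Function.Surjective φ) {ρ ρ' : RepresentationVariety Γ}
    {A B : Tuple n} (hA : IsMinimal A) (hB : IsMinimal B) (hAρ : IsLiftOf φ A ρ)
    (hBρ : IsLiftOf φ B ρ') :
    toCharacterVariety ρ = toCharacterVariety ρ' ↔ UnitaryEquiv A B :=
  ⟨fun h => unitaryEquiv_of_toCharacterVariety_eq hφ h hAρ hBρ hA hB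
    (subset_closure (self_mem_signedOrbit A)) (subset_closure (self_mem_signedOrbit B)),
    fun h => toCharacterVariety_eq_of_mem_closure hφ hAρ hBρ (subset_closure h.mem_signedOrbit)⟩

theorem exists_minimal_lift (hφ : Function.Surjective φ) (η : CharacterVariety Γ) :
    ∃ A, IsMinimal A ∧ ∃ ρ, IsLiftOf φ A ρ ∧ toCharacterVariety ρ = η := by
  obtain ⟨ρ, rfl⟩ := isQuotientMap_toCharacterVariety.surjective η
  obtain ⟨A, hA⟩ := exists_isLiftOf (φ := φ) ρ
  obtain ⟨B, ⟨hB, ρ', hBρ⟩, hBA, -⟩ := exists_mem_minimalLifts hφ hA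
  exact ⟨B, hB, ρ', hBρ, (toCharacterVariety_eq_of_mem_closure hφ hA hBρ hBA).symm⟩

/-- Paths lift from the character variety to the representation variety. -/
theorem exists_path_lift (hφ : Function.Surjective φ) {η : ℝ → CharacterVariety Γ}
    (hη : Continuous η) :
    ∃ ρ : ℝ → RepresentationVariety Γ, Continuous ρ ∧ ∀ t, toCharacterVariety (ρ t) = η t := by
  classical
  -- Sends an orbit of minimal lifts to its class. Elsewhere `q` takes the class of the trivial
  -- representation, so the fiber conditions below are relative to orbits of minimal lifts.
  obtain ⟨q, hq⟩ : ∃ q : OrbitSpace n → CharacterVariety Γ, ∀ A ρ, IsMinimal A →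
      IsLiftOf φ A ρ → q (toOrbit A) = toCharacterVariety ρ := by
    have h (w : OrbitSpace n) : ∃ η : CharacterVariety Γ, ∀ A ρ, IsMinimal A →
        IsLiftOf φ A ρ → toOrbit A = w → η = toCharacterVariety ρ := by
      by_cases hw : ∃ A ρ, IsMinimal A ∧ IsLiftOf φ A ρ ∧ toOrbit A = w
      · obtain ⟨A, ρ, hA, hAρ, rfl⟩ := hw
        refine ⟨toCharacterVariety ρ, fun B ρ' hB hBρ e => ?_⟩
        obtain ⟨k, hk, rfl⟩ := toOrbit_eq_iff.1 e.symm
        exact (toCharacterVariety_eq_iff hφ hA hB hAρ hBρ).2 ⟨1, k, hk, one_smul _ _⟩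
      · exact ⟨toCharacterVariety 1, fun A ρ hA hAρ e => absurd ⟨A, ρ, hA, hAρ, e⟩ hw⟩
    choose q hq using h
    exact ⟨q, fun A ρ hA hAρ => hq _ A ρ hA hAρ rfl⟩
  have hlift : LiftsPaths q (toOrbit '' minimalLifts φ) Set.univ := by
    refine LiftsPaths.of_finite (D := Signs n) ⊤ _ _ ?_ isOpen_univ ?_ ?_ ?_ ?_
    · rintro z - _ ⟨A, ⟨hA, ρ, hAρ⟩, rfl⟩
      rw [signs_smul_toOrbit, hq A ρ hA hAρ, hq _ ρ (hA.signs_smul z) (hAρ.signs_smul z)]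
    · rintro z - _ ⟨A, ⟨hA, ρ, hAρ⟩, rfl⟩
      exact ⟨z • A, ⟨hA.signs_smul z, ρ, hAρ.signs_smul z⟩, rfl⟩
    · rintro _ ⟨A, ⟨hA, ρ, hAρ⟩, rfl⟩ _ ⟨B, ⟨hB, ρ', hBρ⟩, rfl⟩ e
      rw [hq A ρ hA hAρ, hq B ρ' hB hBρ, toCharacterVariety_eq_iff hφ hA hB hAρ hBρ] at e
      obtain ⟨z, k, hk, rfl⟩ := e
      exact ⟨z, trivial, by rw [← toOrbit_smul hk A, signs_smul_toOrbit]⟩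
    · rintro η -
      obtain ⟨A, hA, ρ, hAρ, rfl⟩ := exists_minimal_lift hφ η
      exact ⟨_, ⟨A, ⟨hA, ρ, hAρ⟩, rfl⟩, hq A ρ hA hAρ⟩
    -- The minimal lifts with orbit outside `U` have a closed set of classes, which misses `η`.
    · intro η _ U hU h
      have hcl := isClosed_setOf_toCharacterVariety hφ (hU.preimage continuous_toOrbit).isClosed_compl
      refine Filter.Eventually.mono (hcl.isOpen_compl.mem_nhds ?_) ?_
      · rintro ⟨A, hAU, hA, ρ, hAρ, rfl⟩
        exact hAU (h _ ⟨A, ⟨hA, ρ, hAρ⟩, rfl⟩ (hq A ρ hA hAρ))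
      · rintro η' hη' _ ⟨A, ⟨hA, ρ, hAρ⟩, rfl⟩ e
        by_contra hAU
        exact hη' ⟨A, hAU, hA, ρ, hAρ, (hq A ρ hA hAρ).symm.trans e⟩
  -- The signs are resolved first, giving a path of SU(2)-orbits, and then SU(2).
  obtain ⟨w, hw, hwη⟩ := hlift η hη fun _ => trivial
  obtain ⟨A, hA, hAw⟩ := liftsPaths_toOrbit w hw fun _ => trivial
  have hAmin (t : ℝ) : A t ∈ minimalLifts φ := by
    obtain ⟨⟨B, hB, e⟩, -⟩ := hwη t
    obtain ⟨k, hk, e'⟩ := toOrbit_eq_iff.1 (e.trans (hAw t).2.symm)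
    obtain ⟨ρ, hρ⟩ := hB.2
    rw [← e']
    exact ⟨hB.1.smul hk, _, by simpa using hρ.smul 1 k⟩
  choose ρ hρ using fun t => (hAmin t).2
  refine ⟨ρ, (isInducing_evalGenerators hφ).continuous_iff.2 ?_, fun t => ?_⟩
  · exact (isOpenQuotientMap_toPSL.continuous.comp hA).congr hρ
  · rw [← (hwη t).2, ← (hAw t).2, hq (A t) (ρ t) (hAmin t).1 (hρ t)]

/-- Convergent paths lift from the character variety to convergent paths in the representation
variety. -/
theorem exists_convergent_path_lift (hΓ : Group.FG Γ) {η : ℝ≥0 → CharacterVariety Γ}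
    (hη : Continuous η) {ηInf : CharacterVariety Γ} (hlim : Tendsto η atTop (𝓝 ηInf)) :
    ∃ (ρ : ℝ≥0 → RepresentationVariety Γ) (ρInf : RepresentationVariety Γ), Continuous ρ ∧
      (∀ t, toCharacterVariety (ρ t) = η t) ∧ Tendsto ρ atTop (𝓝 ρInf) ∧
      toCharacterVariety ρInf = ηInf := by
  classical
  obtain ⟨α, hα, φ', hφ'⟩ := Group.fg_iff_exists_freeGroup_hom_surjective_finite.1 hΓ
  obtain ⟨n, ⟨e⟩⟩ := Finite.exists_equiv_fin α
  let φ : FreeGroup (Fin n) →* Γ := φ'.comp (FreeGroup.freeGroupCongr e.symm).toMonoidHom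
  have hφ : Function.Surjective φ := hφ'.comp (FreeGroup.freeGroupCongr e.symm).surjective
  -- The path is run over [0,1) and then stays at its limit; `toNNReal` makes it constant equal to
  -- `η 0` on negative parameters.
  let η' : ℝ → CharacterVariety Γ := fun s => if s < 1 then η (s / (1 - s)).toNNReal else ηInf
  have hη' : Continuous η' := by
    rw [continuous_iff_continuousAt]
    intro s
    rcases lt_trichotomy s 1 with hs | rfl | hs
    · have : ContinuousAt (fun s : ℝ => η (s / (1 - s)).toNNReal) s := by
        refine hη.continuousAt.comp (continuous_real_toNNReal.continuousAt.comp ?_)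
        exact continuousAt_id.div (continuousAt_const.sub continuousAt_id) (by simp; linarith)
      refine this.congr ?_
      filter_upwards [gt_mem_nhds hs] with u hu
      simp [η', hu]
    · have h1 : Tendsto (fun s : ℝ => s / (1 - s)) (𝓝[<] 1) atTop := by
        have h2 : Tendsto (fun s : ℝ => (1 - s)⁻¹) (𝓝[<] 1) atTop := by
          refine tendsto_inv_nhdsGT_zero.comp ?_
          refine tendsto_nhdsWithin_iff.2 ⟨?_, ?_⟩
          · have : Tendsto (fun s : ℝ => 1 - s) (𝓝 1) (𝓝 (1 - 1)) :=
              (continuous_const.sub continuous_id).tendsto 1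
            rw [sub_self] at this
            exact this.mono_left nhdsWithin_le_nhds
          · filter_upwards [self_mem_nhdsWithin] with s hs
            exact sub_pos.2 (Set.mem_Iio.1 hs)
        have h3 : Tendsto (fun s : ℝ => s) (𝓝[<] 1) (𝓝 1) := nhdsWithin_le_nhds
        exact h3.pos_mul_atTop one_pos h2
      have h1' : η' 1 = ηInf := by simp [η']
      rw [continuousAt_iff_continuous_left'_right']
      constructor
      · rw [ContinuousWithinAt, h1']
        refine (hlim.comp (tendsto_real_toNNReal_atTop.comp h1)).congr' ?_
        filter_upwards [self_mem_nhdsWithin] with s hs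
        simp [η', show s < 1 from hs]
      · rw [ContinuousWithinAt, h1']
        refine tendsto_const_nhds.congr' ?_
        filter_upwards [self_mem_nhdsWithin] with s hs
        simp [η', show ¬ s < 1 from not_lt.2 (le_of_lt hs)]
    · refine (continuousAt_const (y := ηInf)).congr ?_
      filter_upwards [lt_mem_nhds hs] with u hu
      simp [η', not_lt.2 hu.le]
  obtain ⟨ρ, hρ, hρη⟩ := exists_path_lift hφ hη'
  have hcont : Continuous fun t : ℝ≥0 => (t : ℝ) / (1 + t) :=
    NNReal.continuous_coe.div (continuous_const.add NNReal.continuous_coe) fun t => by positivity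
  refine ⟨fun t => ρ (t / (1 + t)), ρ 1, hρ.comp hcont, fun t => ?_, ?_, ?_⟩
  · have h1 : (0 : ℝ) < 1 + t := by positivity
    have h2 : (t : ℝ) / (1 + t) < 1 := by rw [div_lt_one h1]; linarith
    have h3 : (t : ℝ) / (1 + t) / (1 - t / (1 + t)) = t := by field_simp; simp
    rw [hρη]
    simp [η', h2, h3]
  · refine (hρ.tendsto 1).comp ?_
    have h1 : Tendsto (fun t : ℝ≥0 => (1 : ℝ) - (1 + (t : ℝ))⁻¹) atTop (𝓝 (1 - 0)) :=
      tendsto_const_nhds.sub (tendsto_inv_atTop_zero.comp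
        (tendsto_atTop_add_const_left _ _ (NNReal.tendsto_coe_atTop.2 tendsto_id)))
    rw [sub_zero] at h1
    refine h1.congr fun t => ?_
    have h1 : (0 : ℝ) < 1 + t := by positivity
    field_simp
    ring
  · rw [hρη]
    simp [η']

end CharacterVarietyPaths

end

/-! ### Deck groups of compact manifolds -/

section DeckGroups

variable {S E : Type*} [TopologicalSpace S] [TopologicalSpace E] {p : E → S}

/-- The source of a local homeomorphism is locally modelled on the target. -/
noncomputable abbrev chartedSpaceOfIsLocalHomeomorph (hp : IsLocalHomeomorph p) :
    ChartedSpace S E where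
  atlas := Set.univ
  chartAt x := (hp x).choose
  mem_chart_source x := (hp x).choose_spec.1
  chart_mem_atlas _ := trivial

theorem _root_.IsCoveringMap.surjective_of_pathConnectedSpace [PathConnectedSpace S] [Nonempty E]
    (hp : IsCoveringMap p) : Function.Surjective p := fun x => by
  obtain ⟨e⟩ := ‹Nonempty E›
  let γ := PathConnectedSpace.somePath (p e) x
  obtain ⟨Γ, hΓ, -⟩ := hp.exists_path_lifts γ e γ.source
  exact ⟨Γ 1, (congrFun hΓ 1).trans γ.target⟩

/-- The projection lifts through itself, sending `x` to `y` or `y` to `x`; uniqueness of lifts makes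
the two lifts inverse to each other. -/
theorem exists_deckGroup_apply_eq [SimplyConnectedSpace E] [LocallyPathConnectedSpace E]
    (hp : IsCoveringMap p) {x y : E} (h : p x = p y) : ∃ γ ∈ DeckGroup p, γ x = y := by
  obtain ⟨F, ⟨hF, hpF⟩, -⟩ := hp.existsUnique_continuousMap_lifts ⟨p, hp.continuous⟩ x y h.symm
  obtain ⟨G, ⟨hG, hpG⟩, -⟩ := hp.existsUnique_continuousMap_lifts ⟨p, hp.continuous⟩ y x h
  have key (F G : C(E, E)) (x y : E) (hF : F x = y) (hG : G y = x) (hpF : p ∘ F = p)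
      (hpG : p ∘ G = p) : G ∘ F = id :=
    hp.eq_of_comp_eq (G.continuous.comp F.continuous) continuous_id
      (by rw [← Function.comp_assoc, hpG, hpF]; rfl) x (by simp [hF, hG])
  refine ⟨⟨⟨F, G, congrFun (key F G x y hF hG hpF hpG), congrFun (key G F y x hG hF hpG hpF)⟩,
    F.continuous, G.continuous⟩, fun z => congrFun hpF z, hF⟩

theorem deckGroup_eq_of_apply_eq [PreconnectedSpace E] (hp : IsCoveringMap p) {γ γ' : E ≃ₜ E}
    (hγ : γ ∈ DeckGroup p) (hγ' : γ' ∈ DeckGroup p) {x : E} (h : γ x = γ' x) : γ = γ' :=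
  DFunLike.coe_injective <| hp.eq_of_comp_eq γ.continuous γ'.continuous
    (funext fun z => (hγ z).trans (hγ' z).symm) x h

/-- Only finitely many deck transformations move a compact set to a set that meets it. -/
theorem finite_setOf_deckGroup_meets [T2Space S] [SimplyConnectedSpace E]
    [LocallyPathConnectedSpace E] (hp : IsCoveringMap p) {K : Set E} (hK : IsCompact K) :
    {γ : DeckGroup p | ∃ x ∈ K, (γ : E ≃ₜ E) x ∈ K}.Finite := by
  by_contra hinf
  have : Infinite {γ : DeckGroup p | ∃ x ∈ K, (γ : E ≃ₜ E) x ∈ K} := Set.infinite_coe_iff.2 hinf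
  -- Along a nonprincipal ultrafilter, `x γ` and its image converge to points of one fiber,
  -- exchanged by some `γ₀`. Local injectivity of `p` then forces `γ = γ₀` eventually, a
  -- contradiction.
  obtain ⟨l, hl⟩ : ∃ l : Ultrafilter {γ : DeckGroup p | ∃ x ∈ K, (γ : E ≃ₜ E) x ∈ K},
      (l : Filter {γ : DeckGroup p | ∃ x ∈ K, (γ : E ≃ₜ E) x ∈ K}) ≤ cofinite :=
    ⟨hyperfilter _, hyperfilter_le_cofinite⟩
  choose x hx hγx using fun γ : {γ : DeckGroup p | ∃ x ∈ K, (γ : E ≃ₜ E) x ∈ K} => γ.2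
  have hlim (f : {γ : DeckGroup p | ∃ x ∈ K, (γ : E ≃ₜ E) x ∈ K} → E) (hf : ∀ γ, f γ ∈ K) :
      ∃ x₀, Tendsto f l (𝓝 x₀) := by
    obtain ⟨x₀, -, h⟩ := hK.ultrafilter_le_nhds (l.map f)
      (le_principal_iff.2 (mem_map.2 (Filter.univ_mem' hf)))
    exact ⟨x₀, h⟩
  obtain ⟨x₀, hx₀'⟩ := hlim x hx
  obtain ⟨y₀, hy₀'⟩ := hlim (fun γ => (γ.1 : E ≃ₜ E) (x γ)) hγx
  have hp₀ : p x₀ = p y₀ := by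
    refine tendsto_nhds_unique ((hp.continuous.tendsto x₀).comp hx₀') ?_
    exact ((hp.continuous.tendsto y₀).comp hy₀').congr fun γ => γ.1.2 (x γ)
  obtain ⟨γ₀, hγ₀, e⟩ := exists_deckGroup_apply_eq hp hp₀
  obtain ⟨U, hU, hx₀U, hinj⟩ := hp.isLocalHomeomorph.isLocallyInjective x₀
  have hback : Tendsto (fun γ => γ₀.symm ((γ.1 : E ≃ₜ E) (x γ))) l (𝓝 x₀) := by
    have := (γ₀.symm.continuous.tendsto y₀).comp hy₀'
    rwa [← e, γ₀.symm_apply_apply] at this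
  have hev : ∀ᶠ γ in (l : Filter {γ : DeckGroup p | ∃ x ∈ K, (γ : E ≃ₜ E) x ∈ K}),
      γ.1 = ⟨γ₀, hγ₀⟩ := by
    filter_upwards [hx₀' (hU.mem_nhds hx₀U), hback (hU.mem_nhds hx₀U)] with γ h1 h2
    have hγ₀' : p (γ₀.symm ((γ.1 : E ≃ₜ E) (x γ))) = p (x γ) := by
      have := hγ₀ (γ₀.symm ((γ.1 : E ≃ₜ E) (x γ)))
      rw [γ₀.apply_symm_apply] at this
      exact this.symm.trans (γ.1.2 (x γ))
    have h3 := hinj h2 h1 hγ₀'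
    rw [γ₀.symm_apply_eq] at h3
    exact Subtype.ext (deckGroup_eq_of_apply_eq hp γ.1.2 hγ₀ h3)
  have hsub : {γ : {γ : DeckGroup p | ∃ x ∈ K, (γ : E ≃ₜ E) x ∈ K} |
      γ.1 = ⟨γ₀, hγ₀⟩}.Subsingleton := fun γ h γ' h' =>
    Subtype.ext ((show γ.1 = ⟨γ₀, hγ₀⟩ from h).trans (show γ'.1 = ⟨γ₀, hγ₀⟩ from h').symm)
  have hne := hl hsub.finite.compl_mem_cofinite
  obtain ⟨γ, h1, h2⟩ := (hev.and hne).exists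
  exact h2 h1

/-- The deck group of the universal covering of a compact manifold is finitely generated. -/
theorem deckGroup_fg {H : Type*} [TopologicalSpace H] [LocallyPathConnectedSpace H]
    [LocallyCompactSpace H] [T2Space S] [CompactSpace S] [ConnectedSpace S] [ChartedSpace H S]
    [SimplyConnectedSpace E] (hp : IsCoveringMap p) : Group.FG (DeckGroup p) := by
  have : LocallyPathConnectedSpace S := ChartedSpace.locallyPathConnectedSpace H S
  have : LocallyCompactSpace S := ChartedSpace.locallyCompactSpace H S
  let _ := chartedSpaceOfIsLocalHomeomorph hp.isLocalHomeomorph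
  have : LocallyPathConnectedSpace E := ChartedSpace.locallyPathConnectedSpace S E
  have : LocallyCompactSpace E := ChartedSpace.locallyCompactSpace S E
  have : PathConnectedSpace S := pathConnectedSpace_iff_connectedSpace.2 inferInstance
  have hsurj := hp.surjective_of_pathConnectedSpace
  -- A compact set whose interior meets every fiber, so that its translates cover.
  obtain ⟨K, hK, hKp⟩ : ∃ K : Set E, IsCompact K ∧ ∀ x, ∃ y ∈ interior K, p y = x := by
    choose s hs using hsurj
    choose N hN hNs using fun x : S => exists_compact_mem_nhds (s x)
    obtain ⟨t, ht⟩ := isCompact_univ.elim_finite_subcover (fun x => p '' interior (N x))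
      (fun x => hp.isOpenMap _ isOpen_interior)
      fun x _ => Set.mem_iUnion.2 ⟨x, s x, mem_interior_iff_mem_nhds.2 (hNs x), hs x⟩
    refine ⟨⋃ x ∈ t, N x, t.isCompact_biUnion fun x _ => hN x, fun x => ?_⟩
    obtain ⟨z, hz, y, hy, rfl⟩ := Set.mem_iUnion₂.1 (ht (Set.mem_univ x))
    exact ⟨y, interior_mono (Set.subset_biUnion_of_mem (u := N) hz) hy, rfl⟩
  set T : Set (DeckGroup p) := {γ | ∃ x ∈ K, (γ : E ≃ₜ E) x ∈ K}
  have hT : T.Finite := finite_setOf_deckGroup_meets hp hK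
  have hcover (x : E) : ∃ (γ : DeckGroup p), ∃ y ∈ interior K, (γ : E ≃ₜ E) y = x := by
    obtain ⟨y, hy, e⟩ := hKp (p x)
    obtain ⟨γ, hγ, rfl⟩ := exists_deckGroup_apply_eq hp e
    exact ⟨⟨γ, hγ⟩, y, hy, rfl⟩
  have hmem {γ γ' : DeckGroup p} {y y' : E} (hy : y ∈ K) (hy' : y' ∈ K)
      (h : (γ : E ≃ₜ E) y = (γ' : E ≃ₜ E) y') : γ'⁻¹ * γ ∈ T := by
    refine ⟨y, hy, ?_⟩
    change (γ' : E ≃ₜ E).symm ((γ : E ≃ₜ E) y) ∈ K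
    rwa [h, Homeomorph.symm_apply_apply]
  let U (A : Set (DeckGroup p)) : Set E := ⋃ γ ∈ A, (γ : E ≃ₜ E) '' interior K
  have hU (A : Set (DeckGroup p)) : IsOpen (U A) :=
    isOpen_biUnion fun γ _ => (γ : E ≃ₜ E).isOpenMap _ isOpen_interior
  set G := Subgroup.closure T
  -- Translates of `K` by `γ` and `γ'` meet only if `γ'⁻¹ * γ` lies in `T`, hence only within a
  -- coset of `G`. So distinct cosets sweep out disjoint open sets, and connectedness leaves only
  -- one.
  have hcompl : (U G)ᶜ = U (G : Set (DeckGroup p))ᶜ := by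
    ext x
    obtain ⟨γ, y, hy, rfl⟩ := hcover x
    have hiff (A : Set (DeckGroup p)) (hA : ∀ γ γ', γ'⁻¹ * γ ∈ T → γ' ∈ A → γ ∈ A) :
        (γ : E ≃ₜ E) y ∈ U A ↔ γ ∈ A := by
      constructor
      · intro h
        obtain ⟨γ', hγ', y', hy', e⟩ := Set.mem_iUnion₂.1 h
        exact hA γ γ' (hmem (interior_subset hy) (interior_subset hy') e.symm) hγ'
      · exact fun h => Set.mem_iUnion₂.2 ⟨γ, h, y, hy, rfl⟩
    have hG (γ γ' : DeckGroup p) (h : γ'⁻¹ * γ ∈ T) : γ' ∈ G ↔ γ ∈ G := by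
      have h' : γ'⁻¹ * γ ∈ G := Subgroup.subset_closure h
      exact ⟨fun hγ' => by simpa using mul_mem hγ' h', fun hγ => by
        simpa using mul_mem hγ (inv_mem h')⟩
    rw [Set.mem_compl_iff, hiff G fun γ γ' h hγ' => (hG γ γ' h).1 hγ',
      hiff (G : Set (DeckGroup p))ᶜ fun γ γ' h hγ' hγ => hγ' ((hG γ γ' h).2 hγ), Set.mem_compl_iff]
  have hclopen : IsClopen (U G) := ⟨⟨hcompl ▸ hU _⟩, hU _⟩
  obtain ⟨y, hy, -⟩ := hKp (Classical.arbitrary S)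
  have huniv : U G = Set.univ :=
    hclopen.eq_univ ⟨y, Set.mem_iUnion₂.2 ⟨1, one_mem G, y, hy, rfl⟩⟩
  refine Group.fg_iff.2 ⟨T, (Subgroup.eq_top_iff' _).2 fun γ => ?_, hT⟩
  obtain ⟨γ', hγ', y', hy', e⟩ := Set.mem_iUnion₂.1 (huniv.ge (Set.mem_univ ((γ : E ≃ₜ E) y)))
  have := mul_mem hγ' (Subgroup.subset_closure
    (hmem (interior_subset hy) (interior_subset hy') e.symm))
  simpa using this

end DeckGroups

/-! ### Continuity of the holonomy map and the conclusion -/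

theorem continuous_holonomy {S E : Type*} [TopologicalSpace E] {p : E → S} :
    Continuous (holonomy (p := p)) :=
  have h : Continuous fun C : DevelopingPair p => (C.dev, C.hol) := continuous_induced_dom
  continuous_quot_lift _ (continuous_quot_mk.comp (continuous_snd.comp h))

end NeckPinching

theorem mainTheorem9 {S E : Type*} [TopologicalSpace S] [T2Space S] [CompactSpace S]
    [ConnectedSpace S] [ChartedSpace (EuclideanSpace ℝ (Fin 2)) S] [IsManifold (𝓡 2) ∞ S]
    (horient : NeckPinching.IsOrientedAtlas S)
    (g : ℕ) (hg : 2 ≤ g) (hgenus : NeckPinching.HasGenus S g)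
    [TopologicalSpace E] [SimplyConnectedSpace E] (p : E → S) (hp : IsCoveringMap p)
    (C : ℝ≥0 → NeckPinching.DeformationSpace p) (hC : Continuous C)
    (ηInf : NeckPinching.CharacterVariety (NeckPinching.DeckGroup p))
    (hη : Tendsto (fun t => NeckPinching.holonomy (C t)) atTop (𝓝 ηInf)) :
    ∃ (ρ : ℝ≥0 → NeckPinching.RepresentationVariety (NeckPinching.DeckGroup p))
      (ρInf : NeckPinching.RepresentationVariety (NeckPinching.DeckGroup p)),
      Continuous ρ ∧
      (∀ t, NeckPinching.toCharacterVariety (ρ t) = NeckPinching.holonomy (C t)) ∧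
      Tendsto ρ atTop (𝓝 ρInf) ∧
      NeckPinching.toCharacterVariety ρInf = ηInf :=
  NeckPinching.exists_convergent_path_lift
    (NeckPinching.deckGroup_fg (H := EuclideanSpace ℝ (Fin 2)) hp)
    (NeckPinching.continuous_holonomy.comp hC) hη
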